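/- **Setting.** Let $\Pi\subset\mathbb R^n$ be a reduced irreducible crystallographic root system spanning the Euclidean space $\mathbb R^n$ with scalar product $\langle\cdot,\cdot\rangle$, let $\Delta=\{\alpha_1,\dots,\alpha_n\}$ be a set of simple roots, and put $\alpha^\vee=2\alpha/\langle\alpha,\alpha\rangle$. Let $\xi$ be the highest root of $\Pi$ and $\eta$ the highest root of the dual root system $\Pi^\vee$ (with respect to $\Delta$ and $\Delta^\vee$). Let $Q=\bigoplus\mathbb Z\alpha_i$, $Q^\vee=\bigoplus\mathbb Z\alpha_i^\vee$, let $P^\vee$ be the $\mathbb Z$-dual lattice of $Q$ and $P$ the $\mathbb Z$-dual lattice of $Q^\vee$, let $c$ be the determinant of the Cartan matrix $(\langle\alpha_i,\alpha_j^\vee\rangle)_{i,j}$, and let $W$ be the Weyl group. The affine Weyl group is $W^{\mathrm{aff}}=Q^\vee\rtimes W$, the dual one is $\widehat W^{\mathrm{aff}}=Q\rtimes W$; both act on $\mathbb R^n$ by $a\mapsto wa+q$, and $\psi$, $\widehat\psi$ denote the retractions $(q,w)\mapsto w$ onto $W$. With $r_v$ the orthogonal reflection in the hyperplane $v^{\perp}$,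 $r_0a=r_\xi a+2\xi/\langle\xi,\xi\rangle$ and $r_0^\vee a=r_\eta a+2\eta/\langle\eta,\eta\rangle$, put $R=\{r_0,r_{\alpha_1},\dots,r_{\alpha_n}\}$ and $R^\vee=\{r_0^\vee,r_{\alpha_1},\dots,r_{\alpha_n}\}$. Put $$F=\{a:\langle a,\alpha_i\rangle\ge 0\ \forall i,\ \langle a,\xi\rangle\le 1\},\qquad F^\vee=\{b:\langle b,\alpha_i^\vee\rangle\ge 0\ \forall i,\ \langle b,\eta\rangle\le 1\}.$$ Let $\sigma,\widetilde\sigma:W\to\{\pm1\}$ be homomorphisms, $W^\sigma=\ker\sigma$, $W^{\mathrm{aff}}_\sigma=Q^\vee\rtimes W^\sigma$, $\widehat W^{\mathrm{aff}}_\sigma=Q\rtimes W^\sigma$. Put $F^\sigma=\{a\in F:\sigma\circ\psi(\mathrm{Stab}_{W^{\mathrm{aff}}}(a))=\{1\}\}$. If $\sigma\ne 1$, choose any $r_\sigma\in R$ with $\sigma\circ\psi(r_\sigma)=-1$; if $\sigma=1$, set $r_\sigma F^\sigma=\emptyset$. Let $F^{\widetilde\sigma,\sigma}$ be the set obtained from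 $F\cup r_\sigma F^\sigma$ by removing the points $a$ with $\widetilde\sigma\circ\psi(\mathrm{Stab}_{W^{\mathrm{aff}}_\sigma}(a))=\{\pm1\}$. Define $F^{\vee\widetilde\sigma,\sigma}$ in the same way from $F^\vee$, $\widehat W^{\mathrm{aff}}$, $\widehat\psi$, $\widehat W^{\mathrm{aff}}_\sigma$ and any $r_\sigma^\vee\in R^\vee$ with $\sigma\circ\widehat\psi(r^\vee_\sigma)=-1$. For a positive integer $M$ put $$F_M^{\widetilde\sigma,\sigma}=\tfrac1M P^\vee\cap F^{\widetilde\sigma,\sigma},\qquad \Lambda_M^{\widetilde\sigma,\sigma}=P\cap M F^{\vee\widetilde\sigma,\sigma},$$ $$\epsilon^\sigma(a)=\frac{|W^\sigma|}{|\mathrm{Stab}_{W^{\mathrm{aff}}_\sigma}(a)|},\qquad h_M^{\vee\sigma}(b)=\bigl|\mathrm{Stab}_{\widehat W^{\mathrm{aff}}_\sigma}(b/M)\bigr|,\qquad \langle f,g\rangle_{F_M^{\widetilde\sigma,\sigma}}=\sum_{a\in F_M^{\widetilde\sigma,\sigma}}\epsilon^\sigma(a)f(a)\overline{g(a)}.$$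 With $\mathrm{cas}(x)=\cos x+\sin x$, the Hartley orbit functions are $$\zeta_b^{\widetilde\sigma,\sigma}(a)=\sum_{w\in W^\sigma}\widetilde\sigma(w)\,\mathrm{cas}(2\pi\langle wb,a\rangle),\qquad a,b\in\mathbb R^n.$$ **Theorem.** For all homomorphisms $\sigma,\widetilde\sigma:W\to\{\pm1\}$, all admissible choices of $r_\sigma$ and $r_\sigma^\vee$, and every positive integer $M$, the set $F_M^{\widetilde\sigma,\sigma}$ is finite, and for all $b,b'\in\Lambda_M^{\widetilde\sigma,\sigma}$ $$\bigl\langle\zeta_b^{\widetilde\sigma,\sigma},\zeta_{b'}^{\widetilde\sigma,\sigma}\bigr\rangle_{F_M^{\widetilde\sigma,\sigma}}=c\,|W^\sigma|\,M^n\,h_M^{\vee\sigma}(b)\,\delta_{b,b'}.$$ -/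

import Mathlib

open scoped RealInnerProductSpace Pointwise

noncomputable section

namespace WeylOrbit

variable {ι E : Type*} [NormedAddCommGroup E] [InnerProductSpace ℝ E]

/-! ### Root systems in a Euclidean space -/

/-- The root pairing `P` lives in the Euclidean space `E`: roots and coroots are vectors of the same
space `E`, the pairing is the scalar product of `E`, and `α^∨ = 2 α / ⟨α, α⟩`. In particular
`P.reflection i` is the orthogonal reflection `a ↦ a - 2 ⟨a, α⟩ / ⟨α, α⟩ α`. -/
structure IsEuclidean (P : RootPairing ι ℝ E E) : Prop where
  pairing_eq : ∀ x y : E, P.toLinearMap x y = ⟪x, y⟫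
  coroot_eq : ∀ i, P.coroot i = (2 / ⟪P.root i, P.root i⟫) • P.root i

/-- `ξ` is (the index of) the highest root: `root j ≤ root ξ` for every root, where `ν ≤ μ` means
that `μ - ν` is a combination of simple roots with coefficients in `ℤ^{≥ 0}`.
For `P.flip`, `B.flip` this is the highest root of the dual root system. -/
def IsHighestRoot (P : RootPairing ι ℝ E E) (B : P.Base) (ξ : ι) : Prop :=
  ∀ j, P.root ξ - P.root j ∈ AddSubmonoid.closure (P.root '' B.support)

/-- The root lattice `Q`. -/
def rootLattice (P : RootPairing ι ℝ E E) (B : P.Base) : Submodule ℤ E :=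
  Submodule.span ℤ (P.root '' B.support)

/-- The dual root lattice `Q^∨`. -/
def corootLattice (P : RootPairing ι ℝ E E) (B : P.Base) : Submodule ℤ E :=
  Submodule.span ℤ (P.coroot '' B.support)

/-- The weight lattice `P`, the `ℤ`-dual of `Q^∨`. -/
def weightLattice (P : RootPairing ι ℝ E E) (B : P.Base) : Set E :=
  {x | ∀ y ∈ corootLattice P B, ∃ k : ℤ, ⟪x, y⟫ = k}

/-- The dual weight lattice `P^∨`, the `ℤ`-dual of `Q`. -/
def coweightLattice (P : RootPairing ι ℝ E E) (B : P.Base) : Set E :=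
  {x | ∀ i ∈ B.support, ∃ k : ℤ, ⟪x, P.root i⟫ = k}

open Classical in
/-- The index of connection, i.e. the determinant of the Cartan matrix. -/
def connectionIndex (P : RootPairing ι ℝ E E) [P.IsCrystallographic] (B : P.Base) : ℤ :=
  B.cartanMatrix.det

/-! ### Affine Weyl groups

For a `W`-invariant lattice `L`, the elements of the semidirect product `L ⋊ W` are the pairs
`g = (q, w)`, acting on `E` by `a ↦ w a + q`; the retraction homomorphism onto `W` is `g ↦ g.2`.
The affine Weyl group is the case `L = Q^∨`, the dual affine Weyl group the case `L = Q`. -/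

/-- The action `a ↦ w a + q` of an element `(q, w)` of `L ⋊ W`. -/
def affAct (P : RootPairing ι ℝ E E) (L : Submodule ℤ E) (g : L × P.weylGroup) (a : E) : E :=
  g.2 • a + (g.1 : E)

/-- The stabilizer of `a` in the even affine group `L ⋊ W^σ`, where `W^σ = ker σ`.
For `σ = 1` it is the stabilizer in `L ⋊ W`. -/
def stab (P : RootPairing ι ℝ E E) (L : Submodule ℤ E) (σ : P.weylGroup →* ℤˣ) (a : E) :
    Set (L × P.weylGroup) :=
  {g | σ g.2 = 1 ∧ affAct P L g a = a}

/-- The set `R = {r_0, r_1, …, r_n}` of generators of the affine Weyl group `Q^∨ ⋊ W`: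
`r_i` are the simple reflections and `r_0 a = r_ξ a + 2 ξ / ⟨ξ, ξ⟩`. -/
def generators (P : RootPairing ι ℝ E E) (B : P.Base) (ξ : ι) :
    Set (corootLattice P B × P.weylGroup) :=
  {g | (∃ i ∈ B.support, g = (0, RootPairing.weylGroup.ofIdx P i)) ∨
    ((g.1 : E) = (2 / ⟪P.root ξ, P.root ξ⟫) • P.root ξ ∧ g.2 = RootPairing.weylGroup.ofIdx P ξ)}

/-- The set `R^∨ = {r_0^∨, r_1, …, r_n}` of generators of the dual affine Weyl group `Q ⋊ W`, where
`r_0^∨ a = r_η a + 2 η / ⟨η, η⟩` for the highest dual root, here `P.coroot η`. -/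
def dualGenerators (P : RootPairing ι ℝ E E) (B : P.Base) (η : ι) :
    Set (rootLattice P B × P.weylGroup) :=
  {g | (∃ i ∈ B.support, g = (0, RootPairing.weylGroup.ofIdx P i)) ∨
    ((g.1 : E) = (2 / ⟪P.coroot η, P.coroot η⟫) • P.coroot η ∧
      g.2 = RootPairing.weylGroup.ofIdx P η)}

/-- `r` is an admissible choice of `r_σ`: an element of `R^σ = {r ∈ R | σ(ψ(r)) = -1}`, or no
element at all if `σ` is trivial (in which case `R^σ` is empty). -/
def IsChoice {P : RootPairing ι ℝ E E} {L : Submodule ℤ E} (R : Set (L × P.weylGroup))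
    (σ : P.weylGroup →* ℤˣ) (r : Option (L × P.weylGroup)) : Prop :=
  (σ = 1 ∧ r = none) ∨ ∃ g ∈ R, σ g.2 = -1 ∧ r = some g

/-- The fundamental simplex `F` of the affine Weyl group. -/
def alcove (P : RootPairing ι ℝ E E) (B : P.Base) (ξ : ι) : Set E :=
  {a | (∀ i ∈ B.support, 0 ≤ ⟪a, P.root i⟫) ∧ ⟪a, P.root ξ⟫ ≤ 1}

/-- The fundamental simplex `F^∨` of the dual affine Weyl group. In the coordinates
`b = ∑ z_i ω_i` one has `z_i = ⟨b, α_i^∨⟩` and `∑ z_i m_i^∨ = ⟨b, η⟩`. -/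
def dualAlcove (P : RootPairing ι ℝ E E) (B : P.Base) (η : ι) : Set E :=
  {b | (∀ i ∈ B.support, 0 ≤ ⟪b, P.coroot i⟫) ∧ ⟪b, P.coroot η⟫ ≤ 1}

/-- For `D = F` and `L = Q^∨` this is `F^σ`, for `D = F^∨` and `L = Q` it is `F^{∨σ}`: the points of
`D` on whose stabilizer in `L ⋊ W` the sign homomorphism takes only the value `1`. -/
def signDomain (P : RootPairing ι ℝ E E) (L : Submodule ℤ E) (D : Set E)
    (σ : P.weylGroup →* ℤˣ) : Set E :=
  {a ∈ D | (fun g : L × P.weylGroup => σ g.2) '' stab P L 1 a = {1}}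

/-- The fundamental domain `D ∪ r_σ D^σ` of the even affine group `L ⋊ W^σ`; it is `D` itself if
`σ` is trivial, when there is no `r_σ`. -/
def evenDomain (P : RootPairing ι ℝ E E) (L : Submodule ℤ E) (D : Set E)
    (σ : P.weylGroup →* ℤˣ) (r : Option (L × P.weylGroup)) : Set E :=
  D ∪ {x | ∃ g ∈ r, x ∈ affAct P L g '' signDomain P L D σ}

/-- The boundary part `H^{τ,σ}` of the fundamental domain (here `τ` is `σ̃`). -/
def boundary (P : RootPairing ι ℝ E E) (L : Submodule ℤ E) (D : Set E)
    (τ σ : P.weylGroup →* ℤˣ) (r : Option (L × P.weylGroup)) : Set E :=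
  {a ∈ evenDomain P L D σ r | (fun g : L × P.weylGroup => τ g.2) '' stab P L σ a = {1, -1}}

/-- The set `F^{τ,σ} = (D ∪ r_σ D^σ) \ H^{τ,σ}`. -/
def domain (P : RootPairing ι ℝ E E) (L : Submodule ℤ E) (D : Set E)
    (τ σ : P.weylGroup →* ℤˣ) (r : Option (L × P.weylGroup)) : Set E :=
  evenDomain P L D σ r \ boundary P L D τ σ r

/-! ### Points, labels, weights -/

/-- The set of points `F_M^{τ,σ} = (1/M) P^∨ ∩ F^{τ,σ}`. -/
def pointSet (P : RootPairing ι ℝ E E) (B : P.Base) (ξ : ι) (τ σ : P.weylGroup →* ℤˣ)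
    (r : Option (corootLattice P B × P.weylGroup)) (M : ℕ) : Set E :=
  ((M : ℝ)⁻¹ • coweightLattice P B) ∩ domain P (corootLattice P B) (alcove P B ξ) τ σ r

/-- The set of labels `Λ_M^{τ,σ} = P ∩ M F^{∨τ,σ}`. -/
def labelSet (P : RootPairing ι ℝ E E) (B : P.Base) (η : ι) (τ σ : P.weylGroup →* ℤˣ)
    (r : Option (rootLattice P B × P.weylGroup)) (M : ℕ) : Set E :=
  weightLattice P B ∩ ((M : ℝ) • domain P (rootLattice P B) (dualAlcove P B η) τ σ r)

/-- `ε^σ(a) = |W^σ| / h^σ(a)`, with `h^σ(a)` the order of the stabilizer of `a` in `Q^∨ ⋊ W^σ`. -/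
def epsilon (P : RootPairing ι ℝ E E) (B : P.Base) (σ : P.weylGroup →* ℤˣ) (a : E) : ℝ :=
  (Nat.card σ.ker : ℝ) / ((stab P (corootLattice P B) σ a).ncard : ℝ)

/-- `h_M^{∨σ}(b)`, the order of the stabilizer of `b / M` in `Q ⋊ W^σ`. -/
def dualStabOrder (P : RootPairing ι ℝ E E) (B : P.Base) (σ : P.weylGroup →* ℤˣ) (M : ℕ)
    (b : E) : ℕ :=
  (stab P (rootLattice P B) σ ((M : ℝ)⁻¹ • b)).ncard

/-! ### Hartley orbit functions and the scalar product -/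

/-- The Hartley kernel. -/
def cas (x : ℝ) : ℝ := Real.cos x + Real.sin x

/-- The Hartley orbit function `ζ_b^{τ,σ}(a) = ∑_{w ∈ W^σ} τ(w) cas(2 π ⟨w b, a⟩)`. -/
def hartley (P : RootPairing ι ℝ E E) (τ σ : P.weylGroup →* ℤˣ) (b a : E) : ℝ :=
  ∑ᶠ w : σ.ker, (((τ w : ℤˣ) : ℤ) : ℝ) * cas (2 * Real.pi * ⟪(w : P.weylGroup) • b, a⟫)

/-- The scalar product `∑_{a ∈ X} ε^σ(a) f(a) conj(g(a))` of functions on a finite set `X`. -/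
def scalarProduct (P : RootPairing ι ℝ E E) (B : P.Base) (σ : P.weylGroup →* ℤˣ) (X : Set E)
    (f g : E → ℂ) : ℂ :=
  ∑ᶠ a ∈ X, (epsilon P B σ a : ℂ) * f a * (starRingEnd ℂ) (g a)

end WeylOrbit

end

/-! For `b ∈ P` the function `ζ_b` is multiplied by `τ(w)` under `(q, w) ∈ Q^∨ ⋊ W^σ`
(`hartley_affAct`). So `ζ_b ζ_{b'}` is invariant under this group and vanishes wherever a
stabilizing element has `τ`-sign `-1`: the removed boundary can be put back into the sum. As `F ∪
r_σ F^σ` meets every orbit exactly once, the weights `ε^σ` turn the scalar product into a plain sum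
over the finite group `(1/M) P^∨ / Q^∨` (`finsum_epsilon_mul_eq`), whose order is `c M^n`
(`card_refinedQuotient`).

There `cas s cas t = cos (s - t) + sin (s + t)`. The character sums are real, so the sines cancel,
while the cosines detect whether a difference of weights lies in `M Q`. What is left is `c M^n |W^σ|
∑ τ(u)`, over `u ∈ W^σ` with `u b - b' ∈ M Q`. Such a `u` puts `b/M` and `b'/M` in one orbit of `Q ⋊
W^σ`, which forces `b = b'`. For `b = b'` these `u` enumerate the stabilizer of `b/M`, on which `τ =
1` because `b/M` avoids the dual boundary.

The geometric input is that the alcove meets each orbit of `Q^∨ ⋊ W` exactly once. Existence: the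
orbit point nearest to an interior point lies in the alcove. Uniqueness: the reflections in the
walls generate the group, each keeps every positive affine root but its own positive, and so a word
joining two alcove points can be shortened to nothing (`foldr_eq_self_of_mem`). The dual statement
is the same one for `P.flip`, and passing from `W` to `W^σ` is formal. -/

namespace WeylOrbit

open Module

/-! ### Euclidean root pairings: duality and invariance of the scalar product -/

section Euclidean

variable {ι E : Type*} [NormedAddCommGroup E] [InnerProductSpace ℝ E] {P : RootPairing ι ℝ E E}

namespace IsEuclidean

lemma inner_root_pos (P : RootPairing ι ℝ E E) (i : ι) : 0 < ⟪P.root i, P.root i⟫ :=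
  real_inner_self_pos.mpr (P.ne_zero i)

/-- Duality: what is proved for `P`, `Q^∨` and the alcove transfers to `P.flip`, `Q` and the dual
alcove. -/
lemma flip (hP : IsEuclidean P) : IsEuclidean P.flip where
  pairing_eq x y := by
    rw [real_inner_comm]
    exact hP.pairing_eq y x
  coroot_eq i := by
    change P.root i = (2 / ⟪P.coroot i, P.coroot i⟫) • P.coroot i
    have h := (inner_root_pos P i).ne'
    rw [hP.coroot_eq, inner_smul_left, inner_smul_right, smul_smul]
    simp only [conj_trivial]
    generalize hr : ⟪P.root i, P.root i⟫ = c at h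
    have : 2 / (2 / c * (2 / c * c)) * (2 / c) = 1 := by field_simp
    rw [this, one_smul]

lemma inner_root_coroot (hP : IsEuclidean P) (i j : ι) :
    ⟪P.root i, P.coroot j⟫ = P.pairing i j :=
  (hP.pairing_eq _ _).symm

lemma inner_root_coroot_int [P.IsCrystallographic] (hP : IsEuclidean P) (i j : ι) :
    ⟪P.root i, P.coroot j⟫ = (P.pairingIn ℤ i j : ℝ) := by
  rw [hP.inner_root_coroot, ← P.algebraMap_pairingIn ℤ]
  simp

lemma reflection_apply (hP : IsEuclidean P) (i : ι) (x : E) :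
    P.reflection i x = x - ⟪x, P.coroot i⟫ • P.root i := by
  rw [RootPairing.reflection_apply, ← hP.pairing_eq]
  rfl

lemma inner_smul_coroot (hP : IsEuclidean P) (i : ι) (x : E) :
    ⟪x, P.coroot i⟫ • P.root i = ⟪x, P.root i⟫ • P.coroot i := by
  rw [hP.coroot_eq, inner_smul_right, smul_smul, mul_comm]

lemma reflection_apply' (hP : IsEuclidean P) (i : ι) (x : E) :
    P.reflection i x = x - ⟪x, P.root i⟫ • P.coroot i := by
  rw [hP.reflection_apply, hP.inner_smul_coroot]

lemma flip_reflection_apply (hP : IsEuclidean P) (i : ι) (x : E) :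
    P.flip.reflection i x = P.reflection i x := by
  rw [hP.flip.reflection_apply, hP.reflection_apply']
  rfl

lemma inner_reflection (hP : IsEuclidean P) (i : ι) (x y : E) :
    ⟪P.reflection i x, P.reflection i y⟫ = ⟪x, y⟫ := by
  have h := (inner_root_pos P i).ne'
  rw [hP.reflection_apply, hP.reflection_apply, hP.coroot_eq]
  simp only [inner_sub_left, inner_sub_right, inner_smul_left, inner_smul_right, conj_trivial,
    real_inner_comm y (P.root i)]
  field_simp
  ring

lemma inner_smul_smul (hP : IsEuclidean P) (w : P.weylGroup) (x y : E) :
    ⟪w • x, w • y⟫ = ⟪x, y⟫ := by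
  obtain ⟨g, hg⟩ := w
  induction hg using RootPairing.weylGroup.induction generalizing x y with
  | mem i => exact hP.inner_reflection i x y
  | one => exact rfl
  | mul g₁ g₂ hg₁ hg₂ h₁ h₂ =>
    rw [← Submonoid.mk_mul_mk _ _ _ hg₁ hg₂, mul_smul, mul_smul, h₁, h₂]

lemma inner_smul_left_eq (hP : IsEuclidean P) (w : P.weylGroup) (x y : E) :
    ⟪w • x, y⟫ = ⟪x, w⁻¹ • y⟫ := by
  rw [← hP.inner_smul_smul w x, smul_inv_smul]

lemma norm_smul (hP : IsEuclidean P) (w : P.weylGroup) (x : E) : ‖w • x‖ = ‖x‖ := by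
  rw [norm_eq_sqrt_real_inner, norm_eq_sqrt_real_inner, hP.inner_smul_smul]

lemma smul_coroot (hP : IsEuclidean P) (w : P.weylGroup) (i : ι) :
    w • P.coroot i = P.coroot (P.weylGroupToPerm w i) := by
  rw [hP.coroot_eq, hP.coroot_eq, ← P.weylGroup_apply_root, hP.inner_smul_smul, smul_comm]

lemma coroot_reflectionPerm_self (i : ι) : P.coroot (P.reflectionPerm i i) = -P.coroot i := by
  simp

end IsEuclidean

lemma weylGroupToPerm_injective (P : RootPairing ι ℝ E E) [P.IsRootSystem] :
    Function.Injective P.weylGroupToPerm := by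
  intro w w' h
  apply Subtype.ext
  apply RootPairing.Equiv.weightHom_injective P
  apply LinearEquiv.toLinearMap_injective
  apply LinearMap.ext_on_range (v := P.root) (by simp)
  intro i
  change w • P.root i = w' • P.root i
  rw [P.weylGroup_apply_root, P.weylGroup_apply_root, h]

instance finite_weylGroup [Finite ι] (P : RootPairing ι ℝ E E) [P.IsRootSystem] :
    Finite P.weylGroup :=
  Finite.of_injective _ (weylGroupToPerm_injective P)

lemma exists_flip_weylGroup (hP : IsEuclidean P) (w : P.weylGroup) :
    ∃ w' : P.flip.weylGroup, ∀ x : E, w' • x = w • x := by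
  obtain ⟨g, hg⟩ := w
  induction hg using RootPairing.weylGroup.induction with
  | mem i => exact ⟨RootPairing.weylGroup.ofIdx P.flip i, hP.flip_reflection_apply i⟩
  | one => exact ⟨1, fun x => rfl⟩
  | mul g₁ g₂ hg₁ hg₂ h₁ h₂ =>
    obtain ⟨w₁, h₁⟩ := h₁
    obtain ⟨w₂, h₂⟩ := h₂
    refine ⟨w₁ * w₂, fun x => ?_⟩
    rw [← Submonoid.mk_mul_mk _ _ _ hg₁ hg₂, mul_smul, mul_smul, h₂, h₁]

/-! ### The lattices -/

lemma coroot_mem_corootLattice (B : P.Base) (i : ι) : P.coroot i ∈ corootLattice P B :=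
  B.coroot_mem_span_int i

lemma root_mem_rootLattice (B : P.Base) (i : ι) : P.root i ∈ rootLattice P B :=
  B.root_mem_span_int i

lemma smul_mem_span {w : P.weylGroup} {s : Set E} {L : Submodule ℤ E} (hs : ∀ x ∈ s, w • x ∈ L)
    {x : E} (hx : x ∈ Submodule.span ℤ s) : w • x ∈ L := by
  have : Submodule.span ℤ s ≤ L.comap (DistribSMul.toAddMonoidHom E w).toIntLinearMap :=
    Submodule.span_le.mpr hs
  exact this hx

lemma smul_mem_corootLattice (hP : IsEuclidean P) (B : P.Base) (w : P.weylGroup) {x : E}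
    (hx : x ∈ corootLattice P B) : w • x ∈ corootLattice P B := by
  refine smul_mem_span ?_ hx
  rintro _ ⟨i, -, rfl⟩
  rw [hP.smul_coroot]
  exact coroot_mem_corootLattice B _

lemma smul_mem_rootLattice (B : P.Base) (w : P.weylGroup) {x : E}
    (hx : x ∈ rootLattice P B) : w • x ∈ rootLattice P B := by
  refine smul_mem_span ?_ hx
  rintro _ ⟨i, -, rfl⟩
  rw [P.weylGroup_apply_root]
  exact root_mem_rootLattice B _

end Euclidean

/-! ### Uniqueness of orbit representatives in a chamber: the exchange argument -/

section Exchange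

variable {X S : Type*} {s : S → X → X} {α : S → X → ℝ} {Pos : Set (X → ℝ)}

/-- Read the word letter by letter and stop where positivity is lost. Since `s j` can expel only `α
j` from `Pos`, the function just before the loss is `α j`. -/
lemma exists_comp_foldr_eq (hPos : ∀ j, ∀ f ∈ Pos, f ≠ α j → f ∘ s j ∈ Pos) {f : X → ℝ}
    (hf : f ∈ Pos) (l : List S) (hl : (fun x => f (l.foldr s x)) ∉ Pos) :
    ∃ l₁ j l₂, l = l₁ ++ j :: l₂ ∧ (fun x => f (l₁.foldr s x)) = α j := by
  induction l using List.reverseRecOn with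
  | nil => exact absurd hf hl
  | append_singleton l j ih =>
    by_cases h : (fun x => f (l.foldr s x)) ∈ Pos
    · refine ⟨l, j, [], rfl, ?_⟩
      by_contra hne
      refine hl ?_
      have := hPos j _ h hne
      simpa [Function.comp_def] using this
    · obtain ⟨l₁, j', l₂, rfl, h'⟩ := ih h
      exact ⟨l₁, j', l₂ ++ [j], by simp, h'⟩

/-- If a word in the reflections maps a point of the chamber to a point of the chamber, then it
fixes this point. -/
lemma foldr_eq_self_of_mem (hinv : ∀ j x, s j (s j x) = x) (hneg : ∀ j x, α j (s j x) = -α j x)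
    (hα : ∀ j, α j ∈ Pos) (hPos : ∀ j, ∀ f ∈ Pos, f ≠ α j → f ∘ s j ∈ Pos)
    (hconj : ∀ (l : List S) i j, (fun x => α i (l.foldr s x)) = α j →
      ∀ x, s i (l.foldr s x) = l.foldr s (s j x))
    (hfix : ∀ j x, α j x = 0 → s j x = x) {F : Set X} (hF : ∀ f ∈ Pos, ∀ x ∈ F, 0 ≤ f x)
    (l : List S) {x : X} (hx : x ∈ F) (hlx : l.foldr s x ∈ F) : l.foldr s x = x := by
  induction hn : l.length using Nat.strong_induction_on generalizing l with
  | _ n ih =>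
  cases l with
  | nil => rfl
  | cons i l =>
    -- If `α i ∘ l` is positive, then `α i` is nonnegative both at `l x` and at its mirror image,
    -- hence zero, and the letter `i` acts trivially. Otherwise `l = l₁ j l₂` with `s i l₁ = l₁ s
    -- j`, and the letters `i` and `j` cancel.
    by_cases h : (fun x => α i (l.foldr s x)) ∈ Pos
    · have h₁ := hF _ h x hx
      have h₂ := hF _ (hα i) _ hlx
      have h₃ : l.foldr s x = (i :: l).foldr s x := by
        have h₄ := hneg i (l.foldr s x)
        simp only [List.foldr_cons] at h₂ ⊢
        exact (hfix i _ (by linarith)).symm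
      rw [← h₃] at hlx ⊢
      exact ih l.length (by simp [← hn]) l hlx rfl
    · obtain ⟨l₁, j, l₂, rfl, hj⟩ := exists_comp_foldr_eq hPos (hα i) l h
      have h₃ : (i :: (l₁ ++ j :: l₂)).foldr s x = (l₁ ++ l₂).foldr s x := by
        simp only [List.foldr_cons, List.foldr_append]
        rw [hconj l₁ i j hj, hinv]
      rw [h₃] at hlx ⊢
      exact ih (l₁ ++ l₂).length (by simp [← hn]) _ hlx rfl

end Exchange

section Euclidean

variable {ι E : Type*} [NormedAddCommGroup E] [InnerProductSpace ℝ E] {P : RootPairing ι ℝ E E}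

/-! ### Heights and the highest root -/

/-- With all values `1` the vector represents the height. With a single nonzero value it is a
multiple of a fundamental coweight. -/
lemma exists_inner_root_eq [FiniteDimensional ℝ E] [P.IsRootSystem] (B : P.Base)
    (c : B.support → ℝ) : ∃ p : E, ∀ i : B.support, ⟪p, P.root i⟫ = c i := by
  let f : E →ₗ[ℝ] ℝ := B.toWeightBasis.constr ℝ c
  refine ⟨(InnerProductSpace.toDual ℝ E).symm f.toContinuousLinearMap, fun i => ?_⟩
  rw [InnerProductSpace.toDual_symm_apply, ← B.toWeightBasis_apply]
  exact B.toWeightBasis.constr_basis ℝ c i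

lemma eq_zero_or_one_le_inner {B : P.Base} {p : E} (hp : ∀ i ∈ B.support, ⟪p, P.root i⟫ = 1)
    {x : E} (hx : x ∈ AddSubmonoid.closure (P.root '' B.support)) : x = 0 ∨ 1 ≤ ⟪p, x⟫ := by
  induction hx using AddSubmonoid.closure_induction with
  | mem x hx =>
    obtain ⟨i, hi, rfl⟩ := hx
    exact Or.inr (hp i hi).ge
  | zero => exact Or.inl rfl
  | add x y _ _ hx hy =>
    rw [inner_add_right]
    rcases hx with rfl | hx
    · simpa using hy
    · right
      rcases hy with rfl | hy
      · simpa using hx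
      · linarith

lemma inner_nonneg_of_mem_closure {B : P.Base} {a : E} (ha : ∀ i ∈ B.support, 0 ≤ ⟪a, P.root i⟫)
    {x : E} (hx : x ∈ AddSubmonoid.closure (P.root '' B.support)) : 0 ≤ ⟪a, x⟫ := by
  induction hx using AddSubmonoid.closure_induction with
  | mem x hx =>
    obtain ⟨i, hi, rfl⟩ := hx
    exact ha i hi
  | zero => simp
  | add x y _ _ hx hy =>
    rw [inner_add_right]
    exact add_nonneg hx hy

lemma root_mem_closure_of_inner_nonneg {B : P.Base} {p : E}
    (hp : ∀ i ∈ B.support, ⟪p, P.root i⟫ = 1) {i : ι} (hi : 0 ≤ ⟪p, P.root i⟫) :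
    P.root i ∈ AddSubmonoid.closure (P.root '' B.support) := by
  refine (B.root_mem_or_neg_mem i).resolve_right fun h => ?_
  rcases eq_zero_or_one_le_inner hp h with h | h
  · exact P.ne_zero i (neg_eq_zero.mp h)
  · rw [inner_neg_right] at h
    linarith

lemma root_reflectionPerm_self (i : ι) : P.root (P.reflectionPerm i i) = -P.root i := by
  simp

section HighestRoot

variable {B : P.Base} {ξ : ι}

/-- The difference `ξ - s_i ξ = ⟨ξ, α_i^∨⟩ α_i` has nonnegative height because `s_i ξ` is a root. -/
lemma IsHighestRoot.inner_nonneg [FiniteDimensional ℝ E] [P.IsRootSystem]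
    (hP : IsEuclidean P) (hξ : IsHighestRoot P B ξ) {i : ι} (hi : i ∈ B.support) :
    0 ≤ ⟪P.root ξ, P.root i⟫ := by
  obtain ⟨p, hp⟩ := exists_inner_root_eq B fun _ => 1
  have h₁ := inner_nonneg_of_mem_closure (B := B) (a := p)
    (fun i hi => by rw [hp ⟨i, hi⟩]; exact zero_le_one) (hξ (P.reflectionPerm i ξ))
  rw [P.root_reflectionPerm, hP.reflection_apply, sub_sub_cancel, inner_smul_right, hp ⟨i, hi⟩,
    hP.coroot_eq, inner_smul_right, mul_one] at h₁
  exact nonneg_of_mul_nonneg_right h₁ (div_pos two_pos (IsEuclidean.inner_root_pos P i))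

lemma IsHighestRoot.inner_coroot_nonneg [FiniteDimensional ℝ E] [P.IsRootSystem]
    (hP : IsEuclidean P) (hξ : IsHighestRoot P B ξ) {x : E}
    (hx : x ∈ AddSubmonoid.closure (P.root '' B.support)) : 0 ≤ ⟪x, P.coroot ξ⟫ := by
  rw [hP.coroot_eq, inner_smul_right, real_inner_comm (P.root ξ) x]
  exact mul_nonneg (div_pos two_pos (IsEuclidean.inner_root_pos P ξ)).le
    (inner_nonneg_of_mem_closure (fun i hi => hξ.inner_nonneg hP hi) hx)

lemma IsHighestRoot.height_pos {p : E} (hp : ∀ i ∈ B.support, ⟪p, P.root i⟫ = 1)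
    (hξ : IsHighestRoot P B ξ) : 1 ≤ ⟪p, P.root ξ⟫ := by
  have h := hξ (P.reflectionPerm ξ ξ)
  rw [root_reflectionPerm_self, sub_neg_eq_add] at h
  have h' : 0 ≤ ⟪p, P.root ξ⟫ := by
    have := inner_nonneg_of_mem_closure (B := B) (a := p)
      (fun i hi => by rw [hp i hi]; exact zero_le_one) h
    rw [inner_add_right] at this
    linarith
  exact (eq_zero_or_one_le_inner hp (root_mem_closure_of_inner_nonneg hp h')).resolve_left
    (P.ne_zero ξ)

/-- Heights suffice, without comparing lengths. With `m = ⟨α, ξ^∨⟩`, the root `-s_ξ α = m ξ - α` is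
at most as high as `ξ`. If `m ≥ 2`, then `ht α ≥ (m - 1) ht ξ ≥ ht ξ`, which is impossible for `α ≠
ξ`. -/
lemma IsHighestRoot.pairingIn_le_one [P.IsCrystallographic] [FiniteDimensional ℝ E] [P.IsRootSystem]
    (hP : IsEuclidean P) (hξ : IsHighestRoot P B ξ) {i : ι} (hi : i ≠ ξ) :
    P.pairingIn ℤ i ξ ≤ 1 := by
  obtain ⟨p, hp⟩ := exists_inner_root_eq B fun _ => 1
  replace hp : ∀ i ∈ B.support, ⟪p, P.root i⟫ = 1 := fun i hi => hp ⟨i, hi⟩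
  by_contra! h
  have h₁ := hξ.height_pos hp
  have h₃ := hξ i
  have h₄ := hξ (P.reflectionPerm (P.reflectionPerm ξ i) (P.reflectionPerm ξ i))
  rw [root_reflectionPerm_self, P.root_reflectionPerm, hP.reflection_apply,
    hP.inner_root_coroot_int] at h₄
  rcases eq_zero_or_one_le_inner hp h₃ with h₅ | h₅
  · exact hi (P.root.injective (sub_eq_zero.mp h₅).symm)
  · have h₆ := inner_nonneg_of_mem_closure (B := B) (a := p)
      (fun i hi => by rw [hp i hi]; exact zero_le_one) h₄
    simp only [inner_sub_right, inner_neg_right, inner_smul_right] at h₅ h₆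
    have h₇ : (2 : ℝ) ≤ P.pairingIn ℤ i ξ := by exact_mod_cast h
    nlinarith

end HighestRoot

end Euclidean

section Affine

variable {ι E : Type*} [NormedAddCommGroup E] [InnerProductSpace ℝ E]

/-! ### The walls of the alcove and the affine reflections in them -/

/-- The inner normals of the walls of the alcove. -/
def wallNormal (P : RootPairing ι ℝ E E) (B : P.Base) (ξ : ι) : Option B.support → E
  | none => -P.root ξ
  | some i => P.root i

/-- The affine functions that are nonnegative on the alcove and vanish on one of its walls. -/
def wall (P : RootPairing ι ℝ E E) (B : P.Base) (ξ : ι) (j : Option B.support) (x : E) : ℝ :=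
  ⟪x, wallNormal P B ξ j⟫ + if j = none then 1 else 0

/-- The affine reflection in a wall of the alcove. -/
noncomputable def wallReflection (P : RootPairing ι ℝ E E) (B : P.Base) (ξ : ι)
    (j : Option B.support) (x : E) : E :=
  x - wall P B ξ j x • (2 / ⟪wallNormal P B ξ j, wallNormal P B ξ j⟫) • wallNormal P B ξ j

/-- The positive affine roots, as functions. -/
def positiveAffineRoots (P : RootPairing ι ℝ E E) (B : P.Base) : Set (E → ℝ) :=
  {f | ∃ (i : ι) (k : ℤ),
    (0 < k ∨ k = 0 ∧ P.root i ∈ AddSubmonoid.closure (P.root '' B.support)) ∧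
      f = fun x => ⟪x, P.root i⟫ + k}

variable {P : RootPairing ι ℝ E E} {B : P.Base} {ξ : ι}

lemma inner_wallNormal_pos (j : Option B.support) :
    0 < ⟪wallNormal P B ξ j, wallNormal P B ξ j⟫ := by
  cases j with
  | none => simpa only [wallNormal, inner_neg_neg] using IsEuclidean.inner_root_pos P ξ
  | some i => exact IsEuclidean.inner_root_pos P i

lemma wall_wallReflection (j : Option B.support) (x : E) :
    wall P B ξ j (wallReflection P B ξ j x) = -wall P B ξ j x := by
  have h := (inner_wallNormal_pos (ξ := ξ) j).ne'
  rw [wallReflection, wall, inner_sub_left, inner_smul_left, inner_smul_left]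
  simp only [conj_trivial]
  rw [div_mul_cancel₀ _ h, sub_add_eq_add_sub]
  change wall P B ξ j x - _ = _
  ring

lemma wallReflection_wallReflection (j : Option B.support) (x : E) :
    wallReflection P B ξ j (wallReflection P B ξ j x) = x := by
  conv_lhs => rw [wallReflection, wall_wallReflection, wallReflection]
  module

lemma wallReflection_some (hP : IsEuclidean P) (i : B.support) (x : E) :
    wallReflection P B ξ (some i) x = P.reflection i x := by
  rw [hP.reflection_apply', hP.coroot_eq]
  simp [wallReflection, wall, wallNormal]

lemma wallReflection_none (hP : IsEuclidean P) (x : E) :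
    wallReflection P B ξ none x = P.reflection ξ x + P.coroot ξ := by
  rw [hP.reflection_apply', hP.coroot_eq]
  simp only [wallReflection, wall, wallNormal, inner_neg_left, inner_neg_right, neg_neg, if_true]
  module

lemma exists_foldr_wallReflection (hP : IsEuclidean P) (l : List (Option B.support)) :
    ∃ (w : P.weylGroup) (t : E), ∀ x, l.foldr (wallReflection P B ξ) x = w • x + t := by
  induction l with
  | nil => exact ⟨1, 0, fun x => by simp⟩
  | cons j l ih =>
    obtain ⟨w, t, h⟩ := ih
    cases j with
    | none =>
      refine ⟨RootPairing.weylGroup.ofIdx P ξ * w, P.reflection ξ t + P.coroot ξ, fun x => ?_⟩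
      rw [List.foldr_cons, h, wallReflection_none hP, map_add, mul_smul, add_assoc]
      rfl
    | some i =>
      refine ⟨RootPairing.weylGroup.ofIdx P i * w, P.reflection i t, fun x => ?_⟩
      rw [List.foldr_cons, h, wallReflection_some hP, map_add, mul_smul]
      rfl

/-- An affine isometry carrying one wall function to another conjugates the corresponding
reflections. -/
lemma wallReflection_foldr (hP : IsEuclidean P) (l : List (Option B.support))
    (i j : Option B.support)
    (h : (fun x => wall P B ξ i (l.foldr (wallReflection P B ξ) x)) = wall P B ξ j) (x : E) :
    wallReflection P B ξ i (l.foldr (wallReflection P B ξ) x) =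
      l.foldr (wallReflection P B ξ) (wallReflection P B ξ j x) := by
  obtain ⟨w, t, hw⟩ := exists_foldr_wallReflection (B := B) (ξ := ξ) hP l
  simp only [hw] at h ⊢
  -- Subtracting the values at `0` removes the constant terms and leaves the linear parts.
  have hn : wallNormal P B ξ i = w • wallNormal P B ξ j := by
    refine ext_inner_left ℝ fun y => ?_
    have h₁ := congrFun h (w⁻¹ • y)
    have h₀ := congrFun h 0
    simp only [wall, smul_inv_smul, smul_zero, inner_add_left, inner_zero_left] at h₀ h₁
    have h₂ := hP.inner_smul_left_eq w⁻¹ y (wallNormal P B ξ j)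
    rw [inv_inv] at h₂
    rw [← h₂]
    linarith
  have hx : wall P B ξ i (w • x + t) = wall P B ξ j x := congrFun h x
  rw [wallReflection, hx, hn, hP.inner_smul_smul, wallReflection, smul_sub, smul_comm w,
    smul_comm w]
  abel

/-! ### Wall reflections acting on positive affine roots -/

section Highest

lemma wall_mem_positiveAffineRoots (j : Option B.support) :
    wall P B ξ j ∈ positiveAffineRoots P B := by
  cases j with
  | none =>
    refine ⟨P.reflectionPerm ξ ξ, 1, Or.inl one_pos, ?_⟩
    funext x
    rw [root_reflectionPerm_self]
    simp [wall, wallNormal]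
  | some i =>
    refine ⟨i, 0, Or.inr ⟨rfl, AddSubmonoid.subset_closure ⟨i, i.2, rfl⟩⟩, ?_⟩
    funext x
    simp [wall, wallNormal]

lemma nonneg_of_mem_positiveAffineRoots (hξ : IsHighestRoot P B ξ) {f : E → ℝ}
    (hf : f ∈ positiveAffineRoots P B) {x : E} (hx : x ∈ alcove P B ξ) : 0 ≤ f x := by
  obtain ⟨i, k, hk | ⟨rfl, hi⟩, rfl⟩ := hf
  · have h := inner_nonneg_of_mem_closure hx.1 (hξ (P.reflectionPerm i i))
    rw [root_reflectionPerm_self, sub_neg_eq_add, inner_add_right] at h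
    have h₁ : (1 : ℝ) ≤ k := by exact_mod_cast hk
    have h₂ := hx.2
    change 0 ≤ _ + (k : ℝ)
    linarith
  · simpa using inner_nonneg_of_mem_closure hx.1 hi

variable [Finite ι] [FiniteDimensional ℝ E] [P.IsRootSystem] [P.IsCrystallographic] [P.IsReduced]

/-- A simple reflection leaves `k` alone and permutes the positive roots other than its own. The
affine reflection sends `(α, k)` to `(s_ξ α, k + m)` with `m = ⟨α, ξ^∨⟩`. As `|m| ≤ 1` unless `α =
±ξ`, only small `k` needs care. -/
lemma comp_wallReflection_mem (hP : IsEuclidean P) (hξ : IsHighestRoot P B ξ)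
    (j : Option B.support) (f : E → ℝ) (hf : f ∈ positiveAffineRoots P B) (hj : f ≠ wall P B ξ j) :
    f ∘ wallReflection P B ξ j ∈ positiveAffineRoots P B := by
  obtain ⟨p, hp⟩ := exists_inner_root_eq B fun _ => 1
  replace hp : ∀ i ∈ B.support, ⟪p, P.root i⟫ = 1 := fun i hi => hp ⟨i, hi⟩
  have hnn {x : E} (hx : x ∈ AddSubmonoid.closure (P.root '' B.support)) : 0 ≤ ⟪p, x⟫ :=
    inner_nonneg_of_mem_closure (fun i hi => by rw [hp i hi]; exact zero_le_one) hx
  have hinner (i l : ι) (x : E) :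
      ⟪P.reflection l x, P.root i⟫ = ⟪x, P.root (P.reflectionPerm l i)⟫ := by
    rw [P.root_reflectionPerm, ← hP.inner_reflection l x, P.reflection_same]
  obtain ⟨i, k, hk, rfl⟩ := hf
  cases j with
  | some j =>
    refine ⟨P.reflectionPerm j i, k, ?_, ?_⟩
    · refine hk.imp id fun ⟨hk, hi⟩ => ⟨hk, ?_⟩
      subst hk
      have hij : i ≠ j := by
        rintro rfl
        refine hj ?_
        funext x
        simp [wall, wallNormal]
      have hpos (l : ι) : B.IsPos l ↔
          P.root l ∈ AddSubmonoid.closure (P.root '' B.support) := by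
        have key (l : ι) (hl : B.IsPos l) :
            P.root l ∈ AddSubmonoid.closure (P.root '' B.support) := by
          refine hl.induction_on_add
            (p := fun l => P.root l ∈ AddSubmonoid.closure (P.root '' B.support))
            (fun i hi => AddSubmonoid.subset_closure ⟨i, hi, rfl⟩) ?_
          intro i j k hk hi hj
          rw [hk]
          exact add_mem hi (AddSubmonoid.subset_closure ⟨j, hj, rfl⟩)
        refine ⟨key l, fun h => ?_⟩
        rcases RootPairing.Base.IsPos.or_neg B l with h' | h'
        · exact h'
        · have h₁ := key _ h'
          change P.root (P.reflectionPerm l l) ∈ _ at h₁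
          rw [root_reflectionPerm_self] at h₁
          have h₂ := hnn h
          rcases eq_zero_or_one_le_inner hp h₁ with h₃ | h₃
          · exact absurd (neg_eq_zero.mp h₃) (P.ne_zero l)
          · rw [inner_neg_right] at h₃
            linarith
      exact (hpos _).mp (((hpos i).mpr hi).reflectionPerm j.2 hij)
    · funext x
      simp only [Function.comp_apply, wallReflection_some hP, hinner]
  | none =>
    refine ⟨P.reflectionPerm ξ i, k + P.pairingIn ℤ i ξ, ?_, ?_⟩
    swap
    · funext x
      simp only [Function.comp_apply, wallReflection_none hP, inner_add_left, hinner]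
      rw [real_inner_comm (P.root i), hP.inner_root_coroot_int]
      push_cast
      ring
    have hξ₁ := hξ.height_pos hp
    by_cases hi : i = ξ
    · subst hi
      have : P.pairingIn ℤ i i = 2 := by simp
      left
      omega
    -- For `α = -ξ` one has `m = -2`. The value `k = 1` is the wall itself and `k = 0` is not
    -- positive, so `k ≥ 2`; at `k = 2` the image is `ξ` with constant `0`.
    by_cases hi' : i = P.reflectionPerm ξ ξ
    · have hm : P.pairingIn ℤ i ξ = -2 := by
        rw [hi', RootPairing.pairingIn_reflectionPerm_self_left]
        simp
      have hk₁ : k ≠ 1 := by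
        rintro rfl
        refine hj ?_
        funext x
        rw [hi', root_reflectionPerm_self]
        simp [wall, wallNormal]
      have hk₀ : k ≠ 0 := by
        rintro rfl
        have := hnn (hk.resolve_left (lt_irrefl 0)).2
        rw [hi', root_reflectionPerm_self, inner_neg_right] at this
        linarith
      have hk₂ : 2 ≤ k := by omega
      rw [hm]
      rcases hk₂.eq_or_lt with h | h
      · right
        refine ⟨by omega, ?_⟩
        rw [hi', P.reflectionPerm_self]
        exact root_mem_closure_of_inner_nonneg hp (by linarith)
      · left
        omega
    have hm₁ := hξ.pairingIn_le_one hP hi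
    have hm₂ : -1 ≤ P.pairingIn ℤ i ξ := by
      have : P.reflectionPerm i i ≠ ξ := by
        rintro h
        refine hi' (P.root.injective ?_)
        rw [root_reflectionPerm_self, ← h, root_reflectionPerm_self, neg_neg]
      have := hξ.pairingIn_le_one hP this
      rw [RootPairing.pairingIn_reflectionPerm_self_left] at this
      omega
    rcases hk with hk | ⟨rfl, hi⟩
    · by_cases h : 0 < k + P.pairingIn ℤ i ξ
      · exact Or.inl h
      · right
        refine ⟨by omega, root_mem_closure_of_inner_nonneg hp ?_⟩
        -- Here `k = 1`, and the image `α + ξ` is a root of nonnegative height because `-α ≤ ξ`.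
        have hm : P.pairingIn ℤ i ξ = -1 := by omega
        have h₁ := hnn (hξ (P.reflectionPerm i i))
        rw [root_reflectionPerm_self, inner_sub_right, inner_neg_right] at h₁
        rw [P.root_reflectionPerm, hP.reflection_apply, hP.inner_root_coroot_int, hm]
        simp only [Int.cast_neg, Int.cast_one, neg_smul, one_smul, inner_sub_right,
          inner_neg_right]
        linarith
    · have hm₀ : 0 ≤ P.pairingIn ℤ i ξ := by
        have := hξ.inner_coroot_nonneg hP hi
        rw [hP.inner_root_coroot_int] at this
        exact_mod_cast this
      rcases hm₀.eq_or_lt with h | h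
      · right
        refine ⟨by omega, ?_⟩
        rw [P.root_reflectionPerm, hP.reflection_apply, hP.inner_root_coroot_int, ← h]
        simpa using hi
      · left
        omega

lemma foldr_wallReflection_eq_self (hP : IsEuclidean P) (hξ : IsHighestRoot P B ξ)
    (l : List (Option B.support)) {x : E} (hx : x ∈ alcove P B ξ)
    (hlx : l.foldr (wallReflection P B ξ) x ∈ alcove P B ξ) :
    l.foldr (wallReflection P B ξ) x = x :=
  foldr_eq_self_of_mem (α := wall P B ξ) wallReflection_wallReflection wall_wallReflection
    wall_mem_positiveAffineRoots (comp_wallReflection_mem hP hξ) (wallReflection_foldr hP)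
    (fun j x h => by rw [wallReflection, h, zero_smul, sub_zero])
    (fun _ hf _ hx => nonneg_of_mem_positiveAffineRoots hξ hf hx) l hx hlx

end Highest

end Affine

section Words

variable {ι E : Type*} [NormedAddCommGroup E] [InnerProductSpace ℝ E]

/-! ### The affine Weyl group is generated by the reflections in the walls -/

/-- A map is a product of reflections in the walls of the alcove. -/
def IsWord (P : RootPairing ι ℝ E E) (B : P.Base) (ξ : ι) (f : E → E) : Prop :=
  ∃ l : List (Option B.support), ∀ x, l.foldr (wallReflection P B ξ) x = f x

variable {P : RootPairing ι ℝ E E} {B : P.Base} {ξ : ι}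

lemma IsWord.id : IsWord P B ξ fun x => x := ⟨[], fun _ => rfl⟩

lemma IsWord.comp {f g : E → E} (hf : IsWord P B ξ f) (hg : IsWord P B ξ g) :
    IsWord P B ξ fun x => f (g x) := by
  obtain ⟨l, hl⟩ := hf
  obtain ⟨l', hl'⟩ := hg
  exact ⟨l ++ l', fun x => by rw [List.foldr_append, hl', hl]⟩

lemma IsWord.inv {f g : E → E} (hf : IsWord P B ξ f) (hfg : ∀ x, f (g x) = x) :
    IsWord P B ξ g := by
  obtain ⟨l, hl⟩ := hf
  refine ⟨l.reverse, fun x => ?_⟩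
  have key (l : List (Option B.support)) (y : E) :
      l.reverse.foldr (wallReflection P B ξ) (l.foldr (wallReflection P B ξ) y) = y := by
    induction l with
    | nil => rfl
    | cons j l ih =>
      rw [List.reverse_cons, List.foldr_append, List.foldr_cons, List.foldr_cons, List.foldr_nil,
        wallReflection_wallReflection, ih]
  rw [← key l (g x), hl, hfg]

lemma IsWord.wallReflection (j : Option B.support) : IsWord P B ξ (wallReflection P B ξ j) :=
  ⟨[j], fun _ => rfl⟩

variable [Finite ι] [P.IsCrystallographic] [P.IsReduced]

lemma IsWord.reflection (hP : IsEuclidean P) (i : ι) : IsWord P B ξ (P.reflection i) := by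
  refine B.induction_reflect i (p := fun i => IsWord P B ξ (P.reflection i)) ?_ ?_ ?_
  · intro i hi
    rw [P.reflection_reflectionPerm]
    exact (hi.comp hi).comp hi
  · intro i hi
    convert IsWord.wallReflection (P := P) (ξ := ξ) (some ⟨i, hi⟩) using 1
    funext x
    exact (wallReflection_some hP ⟨i, hi⟩ x).symm
  · intro i j hi hj
    have hj' : IsWord P B ξ (P.reflection j) := by
      convert IsWord.wallReflection (P := P) (ξ := ξ) (some ⟨j, hj⟩) using 1
      funext x
      exact (wallReflection_some hP ⟨j, hj⟩ x).symm
    rw [P.reflection_reflectionPerm]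
    exact (hj'.comp hi).comp hj'

lemma IsWord.smul (hP : IsEuclidean P) (w : P.weylGroup) : IsWord P B ξ (w • ·) := by
  obtain ⟨g, hg⟩ := w
  induction hg using RootPairing.weylGroup.induction with
  | mem i => exact IsWord.reflection hP i
  | one => exact IsWord.id
  | mul g₁ g₂ hg₁ hg₂ h₁ h₂ =>
    simp only [← Submonoid.mk_mul_mk _ _ _ hg₁ hg₂, mul_smul]
    exact h₁.comp h₂

/-- The vectors such that the translation by them is a product of reflections in walls. -/
def wordTranslations (P : RootPairing ι ℝ E E) (B : P.Base) (ξ : ι) : AddSubgroup E where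
  carrier := {q | IsWord P B ξ (· + q)}
  zero_mem' := by simpa using IsWord.id
  add_mem' {q q'} hq hq' := by simpa [add_assoc, add_comm q'] using hq.comp hq'
  neg_mem' {q} hq := hq.inv fun x => by simp

omit [Finite ι] [P.IsCrystallographic] [P.IsReduced] in
lemma mem_wordTranslations {q : E} : q ∈ wordTranslations P B ξ ↔ IsWord P B ξ (· + q) := Iff.rfl

/-- Conjugating the translation by `q` with `w` gives the translation by `w q`. -/
lemma smul_mem_wordTranslations (hP : IsEuclidean P) (w : P.weylGroup) {q : E}
    (hq : q ∈ wordTranslations P B ξ) : w • q ∈ wordTranslations P B ξ := by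
  have := ((IsWord.smul hP w).comp hq).comp (IsWord.smul (ξ := ξ) (B := B) hP w⁻¹)
  simpa [mem_wordTranslations, smul_add] using this

variable [FiniteDimensional ℝ E] [P.IsRootSystem]

/-- The affine reflection composed with `s_ξ` is the translation by `ξ^∨`. Apart from `α = ±ξ` the
pairing is `±1`, so `ξ^∨ - s_α ξ^∨ = ±α^∨`. -/
lemma coroot_mem_wordTranslations_of_pairing_ne_zero (hP : IsEuclidean P)
    (hξ : IsHighestRoot P B ξ) {i : ι} (hi : P.pairingIn ℤ i ξ ≠ 0) :
    P.coroot i ∈ wordTranslations P B ξ := by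
  have hξ' : P.coroot ξ ∈ wordTranslations P B ξ := by
    have := (IsWord.wallReflection (P := P) (B := B) (ξ := ξ) none).comp (IsWord.reflection hP ξ)
    simpa [mem_wordTranslations, wallReflection_none hP] using this
  by_cases h₁ : i = ξ
  · rwa [h₁]
  by_cases h₂ : P.reflectionPerm i i = ξ
  · have h := congrArg P.coroot h₂
    rw [IsEuclidean.coroot_reflectionPerm_self] at h
    rw [← h] at hξ'
    simpa using neg_mem hξ'
  have hm₁ := hξ.pairingIn_le_one hP h₁
  have hm₂ := hξ.pairingIn_le_one hP h₂
  rw [RootPairing.pairingIn_reflectionPerm_self_left] at hm₂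
  have h := sub_mem hξ' (smul_mem_wordTranslations hP (RootPairing.weylGroup.ofIdx P i) hξ')
  have h' : RootPairing.weylGroup.ofIdx P i • P.coroot ξ = P.reflection i (P.coroot ξ) := rfl
  rw [h', hP.reflection_apply', sub_sub_cancel, real_inner_comm, hP.inner_root_coroot_int] at h
  have hm : P.pairingIn ℤ i ξ = 1 ∨ P.pairingIn ℤ i ξ = -1 := by omega
  rcases hm with hm | hm
  · simpa [hm] using h
  · simpa [hm] using neg_mem h

variable [P.IsIrreducible]

lemma corootLattice_le_wordTranslations (hP : IsEuclidean P) (hξ : IsHighestRoot P B ξ) {q : E}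
    (hq : q ∈ corootLattice P B) : q ∈ wordTranslations P B ξ := by
  have key (i : ι) : P.coroot i ∈ wordTranslations P B ξ := by
    -- Irreducibility enters here: the orbit of `ξ` spans `E`, so no root is orthogonal to all of
    -- it. The previous lemma then applies to `w⁻¹ α_i`, and `w` carries the result back.
    obtain ⟨w, hw⟩ : ∃ w : P.weylGroup, ⟪P.root i, w • P.root ξ⟫ ≠ 0 := by
      by_contra! h
      have hle : Submodule.span ℝ (MulAction.orbit P.weylGroup (P.root ξ)) ≤
          LinearMap.ker (innerₗ E (P.root i)) := by
        rw [Submodule.span_le]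
        rintro _ ⟨w, rfl⟩
        exact h w
      rw [P.span_orbit_eq_top] at hle
      exact (IsEuclidean.inner_root_pos P i).ne' (hle (Submodule.mem_top (x := P.root i)))
    have h : P.coroot (P.weylGroupToPerm w⁻¹ i) ∈ wordTranslations P B ξ := by
      refine coroot_mem_wordTranslations_of_pairing_ne_zero hP hξ fun h => hw ?_
      have h₁ := hP.inner_root_coroot_int (P.weylGroupToPerm w⁻¹ i) ξ
      rw [h, hP.coroot_eq, inner_smul_right, ← P.weylGroup_apply_root, hP.inner_smul_left_eq,
        inv_inv, Int.cast_zero] at h₁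
      exact (mul_eq_zero.mp h₁).resolve_left
        (div_pos two_pos (IsEuclidean.inner_root_pos P ξ)).ne'
    rw [← hP.smul_coroot] at h
    simpa using smul_mem_wordTranslations hP w h
  have : corootLattice P B ≤ (wordTranslations P B ξ).toIntSubmodule := by
    refine Submodule.span_le.mpr ?_
    rintro _ ⟨i, -, rfl⟩
    exact key i
  exact this hq

/-- Two points of the alcove in the same orbit of the affine Weyl group are equal. -/
lemma affAct_eq_self_of_mem_alcove (hP : IsEuclidean P) (hξ : IsHighestRoot P B ξ)
    (g : corootLattice P B × P.weylGroup) {a : E} (ha : a ∈ alcove P B ξ)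
    (hga : affAct P _ g a ∈ alcove P B ξ) : affAct P _ g a = a := by
  obtain ⟨l, hl⟩ := (mem_wordTranslations.mp (corootLattice_le_wordTranslations hP hξ g.1.2)).comp
    (IsWord.smul hP g.2)
  have h : affAct P _ g a = l.foldr (wallReflection P B ξ) a := (hl a).symm
  rw [h] at hga ⊢
  exact foldr_wallReflection_eq_self hP hξ l ha hga

/-- Two points of the dual alcove in the same orbit of the dual affine Weyl group are equal. -/
lemma affAct_eq_self_of_mem_dualAlcove (hP : IsEuclidean P) {η : ι}
    (hη : IsHighestRoot P.flip B.flip η) (g : rootLattice P B × P.weylGroup) {a : E}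
    (ha : a ∈ dualAlcove P B η) (hga : affAct P _ g a ∈ dualAlcove P B η) :
    affAct P _ g a = a := by
  obtain ⟨w, hw⟩ := exists_flip_weylGroup hP g.2
  have h := affAct_eq_self_of_mem_alcove hP.flip hη (⟨g.1, g.1.2⟩, w) (a := a) ha
  simp only [affAct, hw] at h
  exact h hga

/-! ### Every orbit of the affine Weyl group meets the alcove -/

omit [Finite ι] [P.IsIrreducible] [P.IsReduced] [P.IsCrystallographic] in
lemma exists_interior_point (hξ : IsHighestRoot P B ξ) :
    ∃ p : E, ∀ j, 0 < wall P B ξ j p := by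
  obtain ⟨p, hp⟩ := exists_inner_root_eq B fun _ => 1
  replace hp : ∀ i ∈ B.support, ⟪p, P.root i⟫ = 1 := fun i hi => hp ⟨i, hi⟩
  have h := hξ.height_pos hp
  have h₀ : 0 < ⟪p, P.root ξ⟫ + 1 := by linarith
  -- The scaling makes the height of `ξ` drop below `1`.
  refine ⟨(⟪p, P.root ξ⟫ + 1)⁻¹ • p, fun j => ?_⟩
  cases j with
  | none =>
    simp only [wall, wallNormal, inner_neg_right, inner_smul_left, conj_trivial, if_true]
    rw [neg_add_eq_sub, sub_pos, inv_mul_lt_iff₀ h₀]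
    linarith
  | some i =>
    simp only [wall, wallNormal, inner_smul_left, conj_trivial, hp i i.2, reduceCtorEq, if_false]
    positivity

omit [Finite ι] [P.IsIrreducible] [P.IsReduced] [FiniteDimensional ℝ E] [P.IsRootSystem]
  [P.IsCrystallographic] in
lemma mem_alcove_iff {x : E} : x ∈ alcove P B ξ ↔ ∀ j, 0 ≤ wall P B ξ j x := by
  rw [Option.forall]
  simp only [wall, wallNormal, inner_neg_right, if_true, reduceCtorEq, if_false, add_zero]
  rw [and_comm]
  refine and_congr ?_ ?_
  · simp
  · constructor <;> intro h <;> linarith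

omit [Finite ι] [P.IsIrreducible] [P.IsReduced] [FiniteDimensional ℝ E] [P.IsRootSystem]
  [P.IsCrystallographic] in
-- Reflection in a wall separating `x` from `p` decreases the squared distance by `-4 wall(x)
-- wall(p) / |normal|²`.
lemma norm_wallReflection_sub_lt (j : Option B.support) {p x : E} (hp : 0 < wall P B ξ j p)
    (hx : wall P B ξ j x < 0) : ‖wallReflection P B ξ j x - p‖ < ‖x - p‖ := by
  have h := inner_wallNormal_pos (ξ := ξ) (B := B) j
  rw [← sq_lt_sq₀ (norm_nonneg _) (norm_nonneg _)]
  have h₁ : wallReflection P B ξ j x - p = (x - p) -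
      (wall P B ξ j x * (2 / ⟪wallNormal P B ξ j, wallNormal P B ξ j⟫)) • wallNormal P B ξ j := by
    rw [wallReflection, smul_smul]
    abel
  have h₂ : ⟪x - p, wallNormal P B ξ j⟫ = wall P B ξ j x - wall P B ξ j p := by
    rw [wall, wall, inner_sub_left]
    ring
  rw [h₁, norm_sub_sq_real, inner_smul_right, h₂, _root_.norm_smul, mul_pow,
    ← real_inner_self_eq_norm_sq (wallNormal P B ξ j), Real.norm_eq_abs, sq_abs]
  generalize ⟪wallNormal P B ξ j, wallNormal P B ξ j⟫ = c at h
  have h₃ : 2 * (wall P B ξ j x * (2 / c) * (wall P B ξ j x - wall P B ξ j p)) -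
      (wall P B ξ j x * (2 / c)) ^ 2 * c = -(wall P B ξ j x) * wall P B ξ j p * (4 / c) := by
    field_simp
    ring
  have h₄ : 0 < -(wall P B ξ j x) * wall P B ξ j p * (4 / c) := by
    have : 0 < -(wall P B ξ j x) := by linarith
    positivity
  linarith

omit [P.IsIrreducible] [P.IsReduced] [P.IsCrystallographic] in
lemma finite_affAct_mem_ball (hP : IsEuclidean P) (a p : E) (R : ℝ) :
    {g : corootLattice P B × P.weylGroup | ‖affAct P _ g a - p‖ ≤ R}.Finite := by
  have hfin : {q : corootLattice P B | ‖(q : E)‖ ≤ R + ‖p‖ + ‖a‖}.Finite := by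
    have h := ZSpan.setFinite_inter B.toCoweightBasis
      (Metric.isBounded_closedBall (x := (0 : E)) (r := R + ‖p‖ + ‖a‖))
    have hs : Set.range B.toCoweightBasis = P.coroot '' B.support := by
      ext x
      simp
    rw [hs] at h
    refine Set.Finite.of_finite_image (f := Subtype.val) (h.subset ?_) Subtype.val_injective.injOn
    rintro _ ⟨q, hq, rfl⟩
    exact ⟨by simpa using hq, q.2⟩
  refine (hfin.prod (Set.finite_univ (α := P.weylGroup))).subset ?_
  intro g hg
  refine ⟨?_, Set.mem_univ _⟩
  have h : (g.1 : E) = (affAct P _ g a - p) + p - g.2 • a := by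
    rw [affAct]
    abel
  change ‖(g.1 : E)‖ ≤ _
  rw [h]
  refine (norm_sub_le _ _).trans (add_le_add ((norm_add_le _ _).trans ?_) (hP.norm_smul _ _).le)
  exact add_le_add hg le_rfl

omit [P.IsIrreducible] [P.IsReduced] [P.IsCrystallographic] in
/-- Every orbit of the affine Weyl group meets the alcove. -/
lemma exists_affAct_mem_alcove (hP : IsEuclidean P) (hξ : IsHighestRoot P B ξ) (a : E) :
    ∃ g : corootLattice P B × P.weylGroup, affAct P _ g a ∈ alcove P B ξ := by
  obtain ⟨p, hp⟩ := exists_interior_point hξ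
  -- Choose the orbit point nearest to the interior point. Only finitely many group elements bring
  -- `a` at least as near as `a` itself, and a violated wall would give a nearer point.
  obtain ⟨g, hg, hmin⟩ := Set.exists_min_image _ (fun g => ‖affAct P _ g a - p‖)
    (finite_affAct_mem_ball (B := B) hP a p ‖affAct P (corootLattice P B) (0, 1) a - p‖)
    ⟨(0, 1), le_refl ‖affAct P (corootLattice P B) (0, 1) a - p‖⟩
  refine ⟨g, mem_alcove_iff.mpr fun j => ?_⟩
  by_contra! hj
  have hlt := norm_wallReflection_sub_lt j (hp j) hj
  obtain ⟨g', hg'⟩ : ∃ g' : corootLattice P B × P.weylGroup,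
      affAct P _ g' a = wallReflection P B ξ j (affAct P _ g a) := by
    cases j with
    | none =>
      refine ⟨(⟨RootPairing.weylGroup.ofIdx P ξ • (g.1 : E) + P.coroot ξ, add_mem
        (smul_mem_corootLattice hP B _ g.1.2) (coroot_mem_corootLattice B ξ)⟩,
        RootPairing.weylGroup.ofIdx P ξ * g.2), ?_⟩
      simp only [wallReflection_none hP, affAct, mul_smul, map_add, add_assoc]
      rfl
    | some i =>
      refine ⟨(⟨RootPairing.weylGroup.ofIdx P i • (g.1 : E),
        smul_mem_corootLattice hP B _ g.1.2⟩, RootPairing.weylGroup.ofIdx P i * g.2), ?_⟩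
      simp only [wallReflection_some hP, affAct, mul_smul, map_add]
      rfl
  rw [← hg'] at hlt
  exact absurd (hmin g' (hlt.le.trans hg)) (not_le.mpr hlt)

end Words

section EvenDomain

variable {ι E : Type*} [NormedAddCommGroup E] [InnerProductSpace ℝ E] {P : RootPairing ι ℝ E E}
  {L : Submodule ℤ E}

/-! ### Fundamental domains of even affine groups -/

lemma exists_affAct_mul (hL : ∀ (w : P.weylGroup), ∀ x ∈ L, w • x ∈ L) (g h : L × P.weylGroup) :
    ∃ k : L × P.weylGroup, k.2 = g.2 * h.2 ∧ ∀ a, affAct P L k a = affAct P L g (affAct P L h a) :=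
  ⟨(⟨g.2 • (h.1 : E), hL _ _ h.1.2⟩ + g.1, g.2 * h.2), rfl, fun a => by
    simp only [affAct, mul_smul, smul_add, Submodule.coe_add, add_assoc]⟩

lemma exists_affAct_inv (hL : ∀ (w : P.weylGroup), ∀ x ∈ L, w • x ∈ L) (g : L × P.weylGroup) :
    ∃ k : L × P.weylGroup, k.2 = g.2⁻¹ ∧ ∀ a, affAct P L k (affAct P L g a) = a :=
  ⟨(-⟨g.2⁻¹ • (g.1 : E), hL _ _ g.1.2⟩, g.2⁻¹), rfl, fun a => by
    simp only [affAct, smul_add, inv_smul_smul, Submodule.coe_neg, add_neg_cancel_right]⟩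

lemma one_mem_stab (σ : P.weylGroup →* ℤˣ) (a : E) : ((0, 1) : L × P.weylGroup) ∈ stab P L σ a :=
  ⟨map_one σ, by simp [affAct]⟩

variable {D : Set E} {τ σ : P.weylGroup →* ℤˣ}

lemma mem_signDomain {a : E} :
    a ∈ signDomain P L D σ ↔ a ∈ D ∧ ∀ g, affAct P L g a = a → σ g.2 = 1 := by
  refine and_congr_right fun _ => ⟨fun h g hg => ?_, fun h => ?_⟩
  · have : σ g.2 ∈ (fun g : L × P.weylGroup => σ g.2) '' stab P L 1 a := ⟨g, ⟨rfl, hg⟩, rfl⟩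
    rwa [h] at this
  · refine Set.Subset.antisymm ?_ ?_
    · rintro _ ⟨g, hg, rfl⟩
      exact h g hg.2
    · rintro _ rfl
      exact ⟨(0, 1), one_mem_stab 1 a, map_one σ⟩

/-- The identity always contributes the sign `1`, so avoiding the sign set `{1, -1}` means that only
`1` occurs. -/
lemma mem_domain {r : Option (L × P.weylGroup)} {a : E} :
    a ∈ domain P L D τ σ r ↔ a ∈ evenDomain P L D σ r ∧ ∀ g ∈ stab P L σ a, τ g.2 = 1 := by
  refine and_congr_right fun ha => ?_
  rw [boundary, Set.mem_sep_iff, not_and]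
  constructor
  · intro h g hg
    by_contra hne
    refine h ha (Set.Subset.antisymm ?_ ?_)
    · rintro _ ⟨g, -, rfl⟩
      exact Int.units_eq_one_or _
    · rintro _ (rfl | rfl)
      · exact ⟨(0, 1), one_mem_stab σ a, map_one τ⟩
      · exact ⟨g, hg, (Int.units_eq_one_or _).resolve_left hne⟩
  · intro h _ heq
    have : (-1 : ℤˣ) ∈ (fun g : L × P.weylGroup => τ g.2) '' stab P L σ a := by
      rw [heq]
      simp
    obtain ⟨g, hg, hg'⟩ := this
    have h₁ := h g hg
    simp only [h₁] at hg'
    exact absurd hg' (by decide)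

variable {r : Option (L × P.weylGroup)} {R : Set (L × P.weylGroup)}

/-- If distinct points of `D` lie in distinct orbits of `L ⋊ W`, then distinct points of the even
domain lie in distinct orbits of `L ⋊ W^σ`. -/
lemma affAct_eq_self_of_mem_evenDomain (hL : ∀ (w : P.weylGroup), ∀ x ∈ L, w • x ∈ L)
    (hD : ∀ (g : L × P.weylGroup), ∀ a ∈ D, affAct P L g a ∈ D → affAct P L g a = a)
    (hr : IsChoice R σ r) {h : L × P.weylGroup} (hh : σ h.2 = 1) {x : E}
    (hx : x ∈ evenDomain P L D σ r) (hhx : affAct P L h x ∈ evenDomain P L D σ r) :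
    affAct P L h x = x := by
  have hr' : ∀ g ∈ r, σ g.2 = -1 := by
    rcases hr with ⟨-, rfl⟩ | ⟨g, -, hg, rfl⟩
    · simp
    · simpa using hg
  -- The pieces `D` and `r_σ D^σ` share no orbit of `L ⋊ W^σ`: otherwise an element of sign `-1`
  -- would map a point of `D^σ` into `D`, hence fix it.
  have key (g : L × P.weylGroup) (hg : σ g.2 = -1) (z : E) (hz : z ∈ signDomain P L D σ)
      (k : L × P.weylGroup) (hk : σ k.2 = 1) (y : E) (hy : y ∈ D)
      (hyz : affAct P L k y = affAct P L g z) : False := by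
    obtain ⟨g', hg', hgg'⟩ := exists_affAct_inv hL k
    obtain ⟨m, hm, hm'⟩ := exists_affAct_mul hL g' g
    have h₁ : affAct P L m z = y := by rw [hm', ← hyz, hgg']
    rw [mem_signDomain] at hz
    have h₂ := hD m z hz.1 (by rwa [h₁])
    have h₃ := hz.2 m h₂
    rw [hm, hg', map_mul, map_inv, hg, hk] at h₃
    exact absurd h₃ (by decide)
  rcases hx with hx | ⟨g, hg, z, hz, rfl⟩ <;> rcases hhx with hhx | ⟨g', hg', z', hz', hzz'⟩
  · exact hD h x hx hhx
  · exact (key g' (hr' g' hg') z' hz' h hh x hx hzz'.symm).elim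
  · obtain ⟨k, hk, hkk⟩ := exists_affAct_inv hL h
    exact (key g (hr' g hg) z hz k (by rw [hk, map_inv, hh, inv_one]) _ hhx (hkk _)).elim
  · have hgg : g' = g := Option.mem_unique hg' hg
    subst hgg
    obtain ⟨k, hk, hkk⟩ := exists_affAct_inv hL g'
    obtain ⟨m, hm, hm'⟩ := exists_affAct_mul hL h g'
    obtain ⟨n, hn, hn'⟩ := exists_affAct_mul hL k m
    have h₁ : affAct P L n z = z' := by rw [hn', hm', ← hzz', hkk]
    have h₂ := hD n z (mem_signDomain.mp hz).1 (by rw [h₁]; exact (mem_signDomain.mp hz').1)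
    rw [← hzz', ← h₁, h₂]

/-- If every orbit of `L ⋊ W` meets `D`, then every orbit of `L ⋊ W^σ` meets the even domain. -/
lemma exists_affAct_mem_evenDomain (hL : ∀ (w : P.weylGroup), ∀ x ∈ L, w • x ∈ L)
    (hD : ∀ a, ∃ g : L × P.weylGroup, affAct P L g a ∈ D) (hr : IsChoice R σ r) (a : E) :
    ∃ g : L × P.weylGroup, σ g.2 = 1 ∧ affAct P L g a ∈ evenDomain P L D σ r := by
  obtain ⟨k, hk⟩ := hD a
  rcases Int.units_eq_one_or (σ k.2) with h | h
  · exact ⟨k, h, Or.inl hk⟩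
  -- A wrong sign is corrected by a stabilizing element of sign `-1` if there is one. If there is
  -- none, the point lies in `D^σ` and `r_σ` corrects the sign.
  by_cases hs : ∃ s, affAct P L s (affAct P L k a) = affAct P L k a ∧ σ s.2 ≠ 1
  · obtain ⟨s, hs, hs'⟩ := hs
    obtain ⟨m, hm, hm'⟩ := exists_affAct_mul hL s k
    refine ⟨m, ?_, Or.inl (by rwa [hm', hs])⟩
    rw [hm, map_mul, h, (Int.units_eq_one_or _).resolve_left hs']
    decide
  · push Not at hs
    rcases hr with ⟨rfl, -⟩ | ⟨g, -, hg, rfl⟩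
    · exact absurd h (by simp)
    · obtain ⟨m, hm, hm'⟩ := exists_affAct_mul hL g k
      refine ⟨m, ?_, Or.inr ⟨g, rfl, _, mem_signDomain.mpr ⟨hk, hs⟩, (hm' a).symm⟩⟩
      rw [hm, map_mul, h, hg]
      decide

end EvenDomain

section Lattice

variable {ι E : Type*} [NormedAddCommGroup E] [InnerProductSpace ℝ E] {P : RootPairing ι ℝ E E}

/-! ### The refined dual weight lattice and its index -/

/-- The lattice `(1/M) P^∨`. -/
def refinedLattice (P : RootPairing ι ℝ E E) (B : P.Base) (M : ℕ) : Submodule ℤ E where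
  carrier := {x | ∀ y ∈ rootLattice P B, ∃ k : ℤ, M * ⟪x, y⟫ = k}
  zero_mem' y _ := ⟨0, by simp⟩
  add_mem' {x x'} hx hx' y hy := by
    obtain ⟨k, hk⟩ := hx y hy
    obtain ⟨k', hk'⟩ := hx' y hy
    exact ⟨k + k', by rw [inner_add_left, mul_add, hk, hk', Int.cast_add]⟩
  smul_mem' c x hx y hy := by
    obtain ⟨k, hk⟩ := hx y hy
    refine ⟨c * k, ?_⟩
    rw [← Int.cast_smul_eq_zsmul ℝ, inner_smul_left, conj_trivial, mul_left_comm, hk, Int.cast_mul]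

variable {B : P.Base} {M : ℕ}

lemma mem_refinedLattice_iff {x : E} :
    x ∈ refinedLattice P B M ↔ ∀ i : B.support, ∃ k : ℤ, M * ⟪x, P.root i⟫ = k := by
  refine ⟨fun h i => h _ (root_mem_rootLattice B i), fun h y hy => ?_⟩
  induction hy using Submodule.span_induction with
  | mem y hy =>
    obtain ⟨i, hi, rfl⟩ := hy
    exact h ⟨i, hi⟩
  | zero => exact ⟨0, by simp⟩
  | add y y' _ _ hy hy' =>
    obtain ⟨k, hk⟩ := hy
    obtain ⟨k', hk'⟩ := hy'
    exact ⟨k + k', by rw [inner_add_right, mul_add, hk, hk', Int.cast_add]⟩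
  | smul c y _ hy =>
    obtain ⟨k, hk⟩ := hy
    refine ⟨c * k, ?_⟩
    rw [← Int.cast_smul_eq_zsmul ℝ, inner_smul_right, mul_left_comm, hk, Int.cast_mul]

lemma mem_inv_smul_coweightLattice (hM : 0 < M) {x : E} :
    x ∈ (M : ℝ)⁻¹ • coweightLattice P B ↔ x ∈ refinedLattice P B M := by
  have hM' : (M : ℝ) ≠ 0 := by positivity
  rw [Set.mem_inv_smul_set_iff₀ hM', mem_refinedLattice_iff]
  simp [coweightLattice, inner_smul_left]

lemma smul_mem_refinedLattice (hP : IsEuclidean P) (w : P.weylGroup) {x : E}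
    (hx : x ∈ refinedLattice P B M) : w • x ∈ refinedLattice P B M := fun y hy => by
  rw [hP.inner_smul_left_eq]
  exact hx _ (smul_mem_rootLattice B _ hy)

lemma corootLattice_le_refinedLattice [P.IsCrystallographic] (hP : IsEuclidean P) :
    corootLattice P B ≤ refinedLattice P B M := by
  refine Submodule.span_le.mpr ?_
  rintro _ ⟨i, -, rfl⟩
  refine mem_refinedLattice_iff.mpr fun j => ⟨M * P.pairingIn ℤ j i, ?_⟩
  rw [real_inner_comm, hP.inner_root_coroot_int]
  push_cast
  rfl

/-- The quotient `(1/M) P^∨ / Q^∨`. -/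
abbrev RefinedQuotient (P : RootPairing ι ℝ E E) (B : P.Base) (M : ℕ) : Type _ :=
  refinedLattice P B M ⧸ (corootLattice P B).submoduleOf (refinedLattice P B M)

/-- The Cartan matrix is a positive definite Gram matrix times a positive diagonal matrix. -/
lemma connectionIndex_pos [P.IsCrystallographic] (hP : IsEuclidean P) :
    0 < connectionIndex P B := by
  classical
  have h : B.cartanMatrix.map (Int.cast : ℤ → ℝ) =
      Matrix.gram ℝ (fun i : B.support => P.root i) *
        Matrix.diagonal fun i : B.support => 2 / ⟪P.root i, P.root i⟫ := by
    ext i j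
    rw [Matrix.mul_diagonal, Matrix.map_apply, Matrix.gram_apply, RootPairing.Base.cartanMatrix,
      RootPairing.Base.cartanMatrixIn_def, ← hP.inner_root_coroot_int, hP.coroot_eq,
      inner_smul_right, mul_comm]
  have h₁ : (0 : ℝ) < (B.cartanMatrix.map (Int.cast : ℤ → ℝ)).det := by
    rw [h, Matrix.det_mul, Matrix.det_diagonal]
    exact mul_pos (Matrix.posDef_gram_of_linearIndependent B.linearIndepOn_root).det_pos
      (Finset.prod_pos fun i _ => div_pos two_pos (IsEuclidean.inner_root_pos P i))
  have h₂ : ((connectionIndex P B : ℤ) : ℝ) = (B.cartanMatrix.map (Int.cast : ℤ → ℝ)).det := by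
    rw [connectionIndex, Int.cast_det]
  rw [← h₂] at h₁
  exact_mod_cast h₁

variable [FiniteDimensional ℝ E] [P.IsRootSystem]

/-- The coordinates with respect to the dual basis, scaled by `1/M`, of the simple roots. -/
noncomputable def refinedCoordinates (P : RootPairing ι ℝ E E) [P.IsRootSystem] (B : P.Base)
    (hM : 0 < M) : E ≃ₗ[ℝ] (B.support → ℝ) :=
  LinearEquiv.ofBijective
    (LinearMap.pi fun i : B.support => (M : ℝ) • innerₗ E (P.root i)) <| by
    have hM' : (M : ℝ) ≠ 0 := by positivity
    constructor
    · rw [← LinearMap.ker_eq_bot, LinearMap.ker_eq_bot']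
      intro x hx
      have h : innerₗ E x = 0 := B.toWeightBasis.ext fun i => by
        have := congrFun hx i
        simpa [hM', real_inner_comm] using this
      exact inner_self_eq_zero.mp (LinearMap.congr_fun h x)
    · intro c
      obtain ⟨p, hp⟩ := exists_inner_root_eq B fun i => (M : ℝ)⁻¹ * c i
      refine ⟨p, funext fun i => ?_⟩
      have := hp i
      rw [real_inner_comm] at this
      simp [this, hM']

lemma refinedCoordinates_apply (hM : 0 < M) (x : E) (i : B.support) :
    refinedCoordinates P B hM x i = M * ⟪x, P.root i⟫ := by
  rw [real_inner_comm]
  rfl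

/-- The real basis of `E` that is an integral basis of `(1/M) P^∨`. -/
noncomputable def refinedBasis (P : RootPairing ι ℝ E E) [P.IsRootSystem] (B : P.Base)
    (hM : 0 < M) : Basis B.support ℝ E :=
  Basis.ofEquivFun (refinedCoordinates P B hM)

lemma refinedBasis_repr (hM : 0 < M) (x : E) (i : B.support) :
    (refinedBasis P B hM).repr x i = M * ⟪x, P.root i⟫ := by
  rw [← refinedCoordinates_apply hM]
  rfl

lemma span_refinedBasis (hM : 0 < M) :
    Submodule.span ℤ (Set.range (refinedBasis P B hM)) = refinedLattice P B M := by
  ext x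
  rw [Basis.mem_span_iff_repr_mem, mem_refinedLattice_iff]
  refine forall_congr' fun i => ?_
  rw [refinedBasis_repr]
  exact exists_congr fun k => eq_comm

omit [FiniteDimensional ℝ E] in
lemma span_toCoweightBasis :
    Submodule.span ℤ (Set.range B.toCoweightBasis) = corootLattice P B := by
  have hs : Set.range B.toCoweightBasis = P.coroot '' B.support := by
    ext x
    simp
  rw [hs, corootLattice]

/-- The index is the absolute determinant of a basis of `Q^∨` written in a basis of `(1/M) P^∨`. In
the basis dual to the `M α_i`, the coordinates of `α_j^∨` are `M ⟨α_i, α_j^∨⟩`, so the matrix is `M`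
times the Cartan matrix. -/
lemma card_refinedQuotient [P.IsCrystallographic] (hP : IsEuclidean P) (hM : 0 < M) :
    (Nat.card (RefinedQuotient P B M) : ℤ) = connectionIndex P B * M ^ Module.finrank ℝ E := by
  classical
  let b : Basis B.support ℤ (refinedLattice P B M) :=
    ((refinedBasis P B hM).restrictScalars ℤ).map (LinearEquiv.ofEq _ _ (span_refinedBasis hM))
  let bN : Basis B.support ℤ ((corootLattice P B).submoduleOf (refinedLattice P B M)) :=
    ((B.toCoweightBasis.restrictScalars ℤ).map (LinearEquiv.ofEq _ _ span_toCoweightBasis)).map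
      (Submodule.submoduleOfEquivOfLe (corootLattice_le_refinedLattice hP)).symm
  have hb (x : refinedLattice P B M) (i : B.support) :
      (b.repr x i : ℝ) = M * ⟪(x : E), P.root i⟫ := by
    rw [← refinedBasis_repr hM]
    exact Basis.restrictScalars_repr_apply ℤ (refinedBasis P B hM) _ i
  have hbN (i : B.support) : ((bN i : refinedLattice P B M) : E) = P.coroot i := by
    rw [← B.toCoweightBasis_apply, ← Basis.restrictScalars_apply ℤ B.toCoweightBasis]
    rfl
  have := Module.Free.of_basis b
  have := Module.Finite.of_basis b
  rw [← Submodule.natAbs_det_basis_change b _ bN]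
  have hmat : b.toMatrix ((↑) ∘ bN) = (M : ℤ) • B.cartanMatrix := by
    ext i j
    rw [Basis.toMatrix_apply, Matrix.smul_apply]
    have h := hb (bN j) i
    rw [hbN, real_inner_comm, hP.inner_root_coroot_int] at h
    exact_mod_cast h
  have hdet : b.det ((↑) ∘ bN) = connectionIndex P B * M ^ Module.finrank ℝ E := by
    rw [Basis.det_apply, hmat, Matrix.det_smul, mul_comm,
      Module.finrank_eq_card_basis B.toWeightBasis, connectionIndex]
  have hpos : 0 ≤ connectionIndex P B * (M : ℤ) ^ Module.finrank ℝ E :=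
    mul_nonneg (connectionIndex_pos hP).le (by positivity)
  rw [hdet, Int.natAbs_of_nonneg hpos]

lemma finite_refinedQuotient [P.IsCrystallographic] (hP : IsEuclidean P) (hM : 0 < M) :
    Finite (RefinedQuotient P B M) := by
  refine Nat.finite_of_card_ne_zero fun h => ?_
  have h' := card_refinedQuotient (B := B) hP hM
  rw [h] at h'
  have : 0 < connectionIndex P B * (M : ℤ) ^ Module.finrank ℝ E :=
    mul_pos (connectionIndex_pos hP) (by positivity)
  simp only [Nat.cast_zero] at h'
  omega

end Lattice

section Sums

variable {ι E : Type*} [NormedAddCommGroup E] [InnerProductSpace ℝ E] {P : RootPairing ι ℝ E E}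

/-! ### Sums over the finite quotient -/

/-- The translation part of a stabilizing element is forced to be `a - w a`. -/
lemma stab_ncard (L : Submodule ℤ E) (σ : P.weylGroup →* ℤˣ) (a : E) :
    (stab P L σ a).ncard = Nat.card {u : σ.ker // a - (u : P.weylGroup) • a ∈ L} := by
  rw [← Nat.card_coe_set_eq]
  refine Nat.card_congr
    { toFun := fun g => ⟨⟨g.1.2, g.2.1⟩, ?_⟩
      invFun := fun u => ⟨(⟨_, u.2⟩, u.1), u.1.2, ?_⟩
      left_inv := ?_
      right_inv := fun u => rfl }
  · have h : g.1.2 • a + (g.1.1 : E) = a := g.2.2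
    have h' : a - g.1.2 • a = g.1.1 := by rw [sub_eq_iff_eq_add', h]
    rw [h']
    exact g.1.1.2
  · simp [affAct]
  · rintro ⟨⟨q, w⟩, hw, h⟩
    have h : w • a + (q : E) = a := h
    refine Subtype.ext (Prod.ext (Subtype.ext ?_) rfl)
    exact sub_eq_iff_eq_add'.mpr h.symm

lemma stab_ncard_pos [Finite P.weylGroup] (L : Submodule ℤ E) (σ : P.weylGroup →* ℤˣ) (a : E) :
    0 < (stab P L σ a).ncard := by
  rw [stab_ncard]
  have : Nonempty {u : σ.ker // a - (u : P.weylGroup) • a ∈ L} := ⟨⟨1, by simp⟩⟩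
  exact Nat.card_pos

variable {B : P.Base} {M : ℕ}

lemma quotient_mk_eq_iff {a a' : refinedLattice P B M} :
    (Submodule.Quotient.mk a : RefinedQuotient P B M) = Submodule.Quotient.mk a' ↔
      (a : E) - a' ∈ corootLattice P B := by
  rw [Submodule.Quotient.eq]
  rfl

lemma out_sub_mem (a : refinedLattice P B M) :
    (((Submodule.Quotient.mk a : RefinedQuotient P B M).out : refinedLattice P B M) : E) - a ∈
      corootLattice P B := by
  rw [← quotient_mk_eq_iff]
  exact Quotient.out_eq _

variable {D : Set E} {σ : P.weylGroup →* ℤˣ}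

lemma finite_refinedLattice_inter [Finite (RefinedQuotient P B M)]
    (huniq : ∀ (g : corootLattice P B × P.weylGroup), σ g.2 = 1 → ∀ a ∈ D, affAct P _ g a ∈ D →
      affAct P _ g a = a) : ((refinedLattice P B M : Set E) ∩ D).Finite := by
  let f : ((refinedLattice P B M : Set E) ∩ D : Set E) → RefinedQuotient P B M :=
    fun a => Submodule.Quotient.mk ⟨a, a.2.1⟩
  have hf : Function.Injective f := by
    intro a a' h
    have h' := quotient_mk_eq_iff.mp h
    have ha : affAct P _ (⟨_, h'⟩, 1) (a' : E) = a := by simp [affAct]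
    refine Subtype.ext ?_
    rw [← ha]
    exact huniq _ (map_one σ) _ a'.2.2 (by rw [ha]; exact a.2.2)
  exact Set.finite_coe_iff.mp (Finite.of_injective f hf)

open Classical in
/-- Summation over a fundamental domain of `Q^∨ ⋊ W^σ` with the weights `ε^σ` is summation over
`(1/M) P^∨ / Q^∨`. -/
lemma finsum_epsilon_mul_eq [P.IsCrystallographic] [Finite P.weylGroup]
    [Fintype (RefinedQuotient P B M)] (hP : IsEuclidean P)
    (huniq : ∀ (g : corootLattice P B × P.weylGroup), σ g.2 = 1 → ∀ a ∈ D, affAct P _ g a ∈ D →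
      affAct P _ g a = a)
    (hex : ∀ a, ∃ g : corootLattice P B × P.weylGroup, σ g.2 = 1 ∧ affAct P _ g a ∈ D)
    {F : E → ℂ} (hF : ∀ g : corootLattice P B × P.weylGroup, σ g.2 = 1 → ∀ a,
      F (affAct P _ g a) = F a) :
    ∑ᶠ a ∈ (refinedLattice P B M : Set E) ∩ D, (epsilon P B σ a : ℂ) * F a =
      ∑ x : RefinedQuotient P B M, F (x.out : refinedLattice P B M) := by
  have hfin := finite_refinedLattice_inter (M := M) huniq
  have := Fintype.ofFinite σ.ker
  have := hfin.fintype
  -- Double counting: over a class `x` with representative `a` in `D`, the pairs `(w, a)` with `w a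
  -- ≡ x` form a coset of the linear parts of the stabilizer of `a`. Giving each pair the weight `F
  -- a / h(a)` therefore yields `F x`.
  let φ : σ.ker × ((refinedLattice P B M : Set E) ∩ D : Set E) → RefinedQuotient P B M :=
    fun p => Submodule.Quotient.mk ⟨(p.1 : P.weylGroup) • (p.2 : E),
      smul_mem_refinedLattice hP _ p.2.2.1⟩
  let h : E → ℂ := fun a => F a / ((stab P (corootLattice P B) σ a).ncard : ℂ)
  have hL := smul_mem_corootLattice hP B
  have hfib (x : RefinedQuotient P B M) : ∑ p with φ p = x, h p.2 =
      F (x.out : refinedLattice P B M) := by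
    obtain ⟨g, hg, hgx⟩ := hex (x.out : refinedLattice P B M)
    obtain ⟨a, ha⟩ : ∃ a : ((refinedLattice P B M : Set E) ∩ D : Set E),
        (a : E) = affAct P _ g (x.out : refinedLattice P B M) :=
      ⟨⟨_, add_mem (smul_mem_refinedLattice hP _ (Subtype.property _))
        (corootLattice_le_refinedLattice hP g.1.2), hgx⟩, rfl⟩
    have hFa : F a = F (x.out : refinedLattice P B M) := by rw [ha, hF g hg]
    have hφ (p : σ.ker × ((refinedLattice P B M : Set E) ∩ D : Set E)) : φ p = x ↔
        ((p.1 : P.weylGroup) • (p.2 : E)) - (x.out : refinedLattice P B M) ∈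
          corootLattice P B := by
      conv_lhs => rw [← Quotient.out_eq x]
      exact quotient_mk_eq_iff
    have hp₂ (p : σ.ker × ((refinedLattice P B M : Set E) ∩ D : Set E)) (hp : φ p = x) :
        p.2 = a := by
      rw [hφ] at hp
      refine Subtype.ext ?_
      let g' : corootLattice P B × P.weylGroup := (g.1 - ⟨_, hL g.2 hp⟩, g.2 * p.1)
      have h₁ : affAct P _ g' p.2 = a := by
        rw [ha]
        simp only [g', affAct, mul_smul, smul_sub, AddSubgroupClass.coe_sub]
        abel
      have h₂ := huniq g' (by simp [g', hg, MonoidHom.mem_ker.mp p.1.2]) p.2 p.2.2.2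
        (by rw [h₁]; exact a.2.2)
      rw [← h₁, h₂]
    have hcard : (Finset.univ.filter fun p => φ p = x).card =
        (stab P (corootLattice P B) σ a).ncard := by
      rw [stab_ncard, ← Fintype.card_subtype, ← Nat.card_eq_fintype_card]
      have hmem (w : P.weylGroup) :
          w • (a : E) - (x.out : refinedLattice P B M) ∈ corootLattice P B ↔
            (a : E) - (g.2 * w) • (a : E) ∈ corootLattice P B := by
        have h₁ : (a : E) - (g.2 * w) • (a : E) =
            g.1 - g.2 • (w • (a : E) - (x.out : refinedLattice P B M)) := by
          conv_lhs => enter [1]; rw [ha]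
          simp only [affAct, mul_smul, smul_sub]
          abel
        rw [h₁]
        refine ⟨fun h => sub_mem g.1.2 (hL _ h), fun h => ?_⟩
        have h₂ := sub_mem g.1.2 h
        rw [sub_sub_cancel] at h₂
        simpa using hL g.2⁻¹ h₂
      let γ : σ.ker := ⟨g.2, hg⟩
      refine Nat.card_congr
        { toFun := fun p => ⟨γ * p.1.1, ?_⟩
          invFun := fun u => ⟨(γ⁻¹ * u.1, a), ?_⟩
          left_inv := ?_
          right_inv := fun u => Subtype.ext (mul_inv_cancel_left _ _) }
      · have h₁ := (hφ p.1).mp p.2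
        rw [hp₂ p.1 p.2] at h₁
        exact (hmem _).mp h₁
      · rw [hφ]
        refine (hmem _).mpr ?_
        convert u.2 using 3
        exact mul_inv_cancel_left _ _
      · intro p
        exact Subtype.ext (Prod.ext (inv_mul_cancel_left _ _) (hp₂ p.1 p.2).symm)
    rw [Finset.sum_congr rfl fun p hp => by rw [hp₂ p (Finset.mem_filter.mp hp).2],
      Finset.sum_const, hcard, ← hFa, nsmul_eq_mul]
    have := (stab_ncard_pos (corootLattice P B) σ (a : E)).ne'
    exact mul_div_cancel₀ _ (Nat.cast_ne_zero.mpr this)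
  rw [← finsum_set_coe_eq_finsum_mem, finsum_eq_sum_of_fintype,
    Finset.sum_congr rfl fun x _ => (hfib x).symm,
    Finset.sum_fiberwise Finset.univ φ fun p => h p.2, Fintype.sum_prod_type_right]
  refine Finset.sum_congr rfl fun a _ => ?_
  simp only [Finset.sum_const, Finset.card_univ, nsmul_eq_mul, h, epsilon, Nat.card_eq_fintype_card]
  push_cast
  ring

end Sums

section Hartley

variable {ι E : Type*} [NormedAddCommGroup E] [InnerProductSpace ℝ E] {P : RootPairing ι ℝ E E}
  {B : P.Base} {M : ℕ}

/-! ### Hartley orbit functions -/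

lemma cas_two_pi_add_int (t : ℝ) (k : ℤ) :
    cas (2 * Real.pi * (t + k)) = cas (2 * Real.pi * t) := by
  have h : 2 * Real.pi * (t + k) = 2 * Real.pi * t + k * (2 * Real.pi) := by ring
  rw [cas, cas, h, Real.cos_add_int_mul_two_pi, Real.sin_add_int_mul_two_pi]

lemma smul_mem_weightLattice (hP : IsEuclidean P) (w : P.weylGroup) {b : E}
    (hb : b ∈ weightLattice P B) : w • b ∈ weightLattice P B := fun y hy => by
  rw [hP.inner_smul_left_eq]
  exact hb _ (smul_mem_corootLattice hP B _ hy)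

lemma hartley_eq_sum (τ σ : P.weylGroup →* ℤˣ) [Fintype σ.ker] (b a : E) :
    hartley P τ σ b a = ∑ w : σ.ker,
      (((τ w : ℤˣ) : ℤ) : ℝ) * cas (2 * Real.pi * ⟪(w : P.weylGroup) • b, a⟫) :=
  finsum_eq_sum_of_fintype _

/-- A translation in `Q^∨` shifts each `⟨w b, a⟩` by an integer; the linear part is absorbed by
reindexing the sum, at the cost of a sign. -/
lemma hartley_affAct [Finite P.weylGroup] (hP : IsEuclidean P) (τ σ : P.weylGroup →* ℤˣ) {b : E}
    (hb : b ∈ weightLattice P B) (g : corootLattice P B × P.weylGroup) (hg : σ g.2 = 1) (a : E) :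
    hartley P τ σ b (affAct P _ g a) = (((τ g.2 : ℤˣ) : ℤ) : ℝ) * hartley P τ σ b a := by
  have := Fintype.ofFinite σ.ker
  rw [hartley_eq_sum, hartley_eq_sum, Finset.mul_sum]
  let γ : σ.ker := ⟨g.2, hg⟩
  rw [← Equiv.sum_comp (Equiv.mulLeft γ)]
  refine Finset.sum_congr rfl fun w _ => ?_
  obtain ⟨k, hk⟩ := smul_mem_weightLattice hP ((γ * w : σ.ker) : P.weylGroup) hb _ g.1.2
  rw [Equiv.coe_mulLeft, affAct, inner_add_right, hk, cas_two_pi_add_int]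
  simp only [γ, Subgroup.coe_mul, map_mul, Units.val_mul, Int.cast_mul, mul_smul,
    hP.inner_smul_smul, mul_assoc]

lemma weightLattice_sub_mem {b b' : E} (hb : b ∈ weightLattice P B) (hb' : b' ∈ weightLattice P B) :
    b - b' ∈ weightLattice P B := fun y hy => by
  obtain ⟨k, hk⟩ := hb y hy
  obtain ⟨k', hk'⟩ := hb' y hy
  exact ⟨k - k', by rw [inner_sub_left, hk, hk', Int.cast_sub]⟩

lemma weightLattice_add_mem {b b' : E} (hb : b ∈ weightLattice P B) (hb' : b' ∈ weightLattice P B) :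
    b + b' ∈ weightLattice P B := fun y hy => by
  obtain ⟨k, hk⟩ := hb y hy
  obtain ⟨k', hk'⟩ := hb' y hy
  exact ⟨k + k', by rw [inner_add_left, hk, hk', Int.cast_add]⟩

/-- A vector whose scalar products with `(1/M) P^∨` are integral lies in `M Q`. -/
lemma exists_eq_smul_rootLattice [FiniteDimensional ℝ E] [P.IsRootSystem] (hM : 0 < M) {b : E}
    (hb : ∀ y ∈ refinedLattice P B M, ∃ k : ℤ, ⟪b, y⟫ = k) :
    ∃ q ∈ rootLattice P B, b = (M : ℝ) • q := by
  classical
  have hM' : (M : ℝ) ≠ 0 := by positivity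
  have hω (i : B.support) : ∃ k : ℤ, B.toWeightBasis.repr b i = M * k := by
    -- This `ω` is a fundamental coweight divided by `M`, so `⟨b, ω⟩` is the `i`-th simple root
    -- coordinate of `b` divided by `M`.
    obtain ⟨ω, hω⟩ := exists_inner_root_eq B fun j => if j = i then (M : ℝ)⁻¹ else 0
    obtain ⟨k, hk⟩ := hb ω <| mem_refinedLattice_iff.mpr fun j => by
      rw [hω j]
      split_ifs
      · exact ⟨1, by simp [hM']⟩
      · exact ⟨0, by simp⟩
    refine ⟨k, ?_⟩
    have h : ⟪b, ω⟫ = (M : ℝ)⁻¹ * B.toWeightBasis.repr b i := by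
      conv_lhs => rw [← B.toWeightBasis.sum_repr b, sum_inner]
      rw [Finset.sum_eq_single i]
      · rw [inner_smul_left, real_inner_comm, B.toWeightBasis_apply, hω]
        simp [mul_comm]
      · intro j _ hj
        rw [inner_smul_left, real_inner_comm, B.toWeightBasis_apply, hω]
        simp [hj]
      · simp
    rw [← hk, h, mul_inv_cancel_left₀ hM']
  choose k hk using hω
  refine ⟨∑ i, k i • P.root i, Submodule.sum_mem _ fun i _ =>
    Submodule.smul_mem _ _ (root_mem_rootLattice B i), ?_⟩
  conv_lhs => rw [← B.toWeightBasis.sum_repr b]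
  rw [Finset.smul_sum]
  refine Finset.sum_congr rfl fun i _ => ?_
  rw [hk, B.toWeightBasis_apply, mul_smul, Int.cast_smul_eq_zsmul]

open Complex in
lemma exp_two_pi_inner_add {b x y : E} (hy : ∃ k : ℤ, ⟪b, y⟫ = k) :
    exp ((2 * Real.pi * ⟪b, x + y⟫ : ℝ) * I) = exp ((2 * Real.pi * ⟪b, x⟫ : ℝ) * I) := by
  obtain ⟨k, hk⟩ := hy
  rw [inner_add_right, hk, Complex.exp_eq_exp_iff_exists_int]
  exact ⟨k, by push_cast; ring⟩

open Complex Classical in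
lemma sum_exp_two_pi_inner [FiniteDimensional ℝ E] [P.IsRootSystem]
    [Fintype (RefinedQuotient P B M)] (hM : 0 < M) {b : E} (hb : b ∈ weightLattice P B) :
    ∑ x : RefinedQuotient P B M,
        exp ((2 * Real.pi * ⟪b, (x.out : refinedLattice P B M)⟫ : ℝ) * I) =
      ((if ∃ q ∈ rootLattice P B, b = (M : ℝ) • q then
        (Nat.card (RefinedQuotient P B M) : ℝ) else 0 : ℝ) : ℂ) := by
  split_ifs with h
  · obtain ⟨q, hq, rfl⟩ := h
    rw [Finset.sum_congr rfl fun x _ => ?_, Finset.sum_const, Finset.card_univ, nsmul_one,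
      Nat.card_eq_fintype_card, ofReal_natCast]
    obtain ⟨k, hk⟩ := (Quotient.out x : refinedLattice P B M).2 q hq
    rw [Complex.exp_eq_one_iff]
    refine ⟨k, ?_⟩
    rw [inner_smul_left, real_inner_comm, conj_trivial, hk]
    push_cast
    ring
  · have h₁ : ¬ ∀ y ∈ refinedLattice P B M, ∃ k : ℤ, ⟪b, y⟫ = k :=
      fun h₁ => h (exists_eq_smul_rootLattice hM h₁)
    push Not at h₁
    obtain ⟨y, hy, hyk⟩ := h₁
    let y' : refinedLattice P B M := ⟨y, hy⟩
    -- Shifting the summation by `y` multiplies the sum by a number different from `1`. The chosen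
    -- representatives do not matter, because `b ∈ P` makes the exponential constant on classes
    -- modulo `Q^∨`.
    have hmul : (∑ x : RefinedQuotient P B M,
        exp ((2 * Real.pi * ⟪b, (x.out : refinedLattice P B M)⟫ : ℝ) * I)) *
          exp ((2 * Real.pi * ⟪b, y⟫ : ℝ) * I) = ∑ x : RefinedQuotient P B M,
        exp ((2 * Real.pi * ⟪b, (x.out : refinedLattice P B M)⟫ : ℝ) * I) := by
      conv_rhs => rw [← Equiv.sum_comp (Equiv.addRight (Submodule.Quotient.mk y'))]
      rw [Finset.sum_mul]
      refine Finset.sum_congr rfl fun x _ => ?_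
      have h₂ : x + Submodule.Quotient.mk y' = Submodule.Quotient.mk (x.out + y') := by
        conv_lhs => rw [← Quotient.out_eq x]
        rfl
      have h₃ := out_sub_mem (x.out + y')
      have h₄ := exp_two_pi_inner_add (x := ((x.out + y' : refinedLattice P B M) : E)) (hb _ h₃)
      rw [add_sub_cancel] at h₄
      simp only [Equiv.coe_addRight]
      rw [h₂, h₄, Submodule.coe_add, inner_add_right, ← exp_add]
      congr 1
      push_cast
      ring
    rw [ofReal_zero]
    by_contra hne
    have h₅ := mul_left_cancel₀ hne (hmul.trans (mul_one _).symm)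
    rw [Complex.exp_eq_one_iff] at h₅
    obtain ⟨k, hk⟩ := h₅
    refine hyk k ?_
    have hpi : (2 * Real.pi * I : ℂ) ≠ 0 := two_pi_I_ne_zero
    have h₆ : (⟪b, y⟫ : ℂ) * (2 * Real.pi * I) = k * (2 * Real.pi * I) := by
      rw [← hk]
      push_cast
      ring
    exact_mod_cast mul_right_cancel₀ hpi h₆

open Complex in
lemma cas_mul_cas (s t : ℝ) :
    cas s * cas t = (exp ((s - t : ℝ) * I)).re + (exp ((s + t : ℝ) * I)).im := by
  rw [exp_ofReal_mul_I_re, exp_ofReal_mul_I_im, cas, cas, Real.cos_sub, Real.sin_add]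
  ring

open Classical in
/-- Orthogonality of the Hartley kernels on `(1/M) P^∨ / Q^∨`. -/
lemma sum_cas_mul_cas [FiniteDimensional ℝ E] [P.IsRootSystem]
    [Fintype (RefinedQuotient P B M)] (hM : 0 < M) {b b' : E} (hb : b ∈ weightLattice P B)
    (hb' : b' ∈ weightLattice P B) :
    ∑ x : RefinedQuotient P B M,
        cas (2 * Real.pi * ⟪b, (x.out : refinedLattice P B M)⟫) *
          cas (2 * Real.pi * ⟪b', (x.out : refinedLattice P B M)⟫) =
      if ∃ q ∈ rootLattice P B, b - b' = (M : ℝ) • q then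
        (Nat.card (RefinedQuotient P B M) : ℝ) else 0 := by
  have h₁ := congrArg Complex.re (sum_exp_two_pi_inner hM (weightLattice_sub_mem hb hb'))
  -- The sum for `b + b'` is real whether or not `b + b' ∈ M Q`, so the sine part always vanishes.
  have h₂ := congrArg Complex.im (sum_exp_two_pi_inner hM (weightLattice_add_mem hb hb'))
  rw [Complex.re_sum, Complex.ofReal_re] at h₁
  rw [Complex.im_sum, Complex.ofReal_im] at h₂
  refine Eq.trans ?_ ((congrArg₂ (· + ·) h₁ h₂).trans (add_zero _))
  rw [← Finset.sum_add_distrib]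
  refine Finset.sum_congr rfl fun x _ => ?_
  rw [cas_mul_cas, inner_sub_left, inner_add_left, mul_sub, mul_add]

end Hartley

/-! ### Orthogonality of the orbit functions -/

section Main

variable {ι E : Type*} [NormedAddCommGroup E] [InnerProductSpace ℝ E] {P : RootPairing ι ℝ E E}
  {B : P.Base} {M : ℕ}

lemma units_sq_cast (u : ℤˣ) : (((u : ℤ) : ℝ)) * ((u : ℤ) : ℝ) = 1 := by
  rcases Int.units_eq_one_or u with rfl | rfl <;> simp

/-- The orbit function vanishes at the points whose stabilizer contains an element of sign `-1`. -/
lemma hartley_eq_zero [Finite P.weylGroup] (hP : IsEuclidean P) (τ σ : P.weylGroup →* ℤˣ) {b : E}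
    (hb : b ∈ weightLattice P B) {a : E} {g : corootLattice P B × P.weylGroup}
    (hg : g ∈ stab P _ σ a) (hτ : τ g.2 ≠ 1) : hartley P τ σ b a = 0 := by
  have h := hartley_affAct hP τ σ hb g hg.1 a
  rw [hg.2, (Int.units_eq_one_or _).resolve_left hτ] at h
  simp only [Units.val_neg, Units.val_one, Int.cast_neg, Int.cast_one] at h
  linarith

open Classical in
-- Writing the index belonging to `b` as `w u`, with `w` the one belonging to `b'`, makes each term
-- independent of `w`: `M Q` is `W`-invariant and `τ(w u) τ(w) = τ(u)`.
lemma sum_hartley_mul_hartley [Finite P.weylGroup] [FiniteDimensional ℝ E] [P.IsRootSystem]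
    [Fintype (RefinedQuotient P B M)] (hP : IsEuclidean P) (τ σ : P.weylGroup →* ℤˣ)
    [Fintype σ.ker] (hM : 0 < M) {b b' : E}
    (hb : b ∈ weightLattice P B) (hb' : b' ∈ weightLattice P B) :
    ∑ x : RefinedQuotient P B M, hartley P τ σ b (x.out : refinedLattice P B M) *
        hartley P τ σ b' (x.out : refinedLattice P B M) =
      Nat.card (RefinedQuotient P B M) * ∑ _ : σ.ker, ∑ u : σ.ker,
        if ∃ q ∈ rootLattice P B, (u : P.weylGroup) • b - b' = (M : ℝ) • q then
          (((τ u : ℤˣ) : ℤ) : ℝ) else 0 := by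
  simp only [hartley_eq_sum, Finset.sum_mul_sum]
  rw [Finset.sum_comm]
  simp only [Finset.sum_comm (s := (Finset.univ : Finset (RefinedQuotient P B M)))]
  rw [Finset.sum_comm, Finset.mul_sum]
  refine Finset.sum_congr rfl fun w _ => ?_
  rw [← Equiv.sum_comp (Equiv.mulLeft w), Finset.mul_sum]
  refine Finset.sum_congr rfl fun u _ => ?_
  have h := sum_cas_mul_cas hM (smul_mem_weightLattice hP ((w * u : σ.ker) : P.weylGroup) hb)
    (smul_mem_weightLattice hP (w : P.weylGroup) hb')
  have hiff : (∃ q ∈ rootLattice P B, ((w * u : σ.ker) : P.weylGroup) • b -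
      (w : P.weylGroup) • b' = (M : ℝ) • q) ↔
      ∃ q ∈ rootLattice P B, (u : P.weylGroup) • b - b' = (M : ℝ) • q := by
    constructor
    · rintro ⟨q, hq, h⟩
      refine ⟨_, smul_mem_rootLattice B (w : P.weylGroup)⁻¹ hq, ?_⟩
      rw [← smul_comm, ← h, smul_sub, Subgroup.coe_mul, mul_smul, inv_smul_smul, inv_smul_smul]
    · rintro ⟨q, hq, h⟩
      refine ⟨_, smul_mem_rootLattice B (w : P.weylGroup) hq, ?_⟩
      rw [← smul_comm, ← h, smul_sub, Subgroup.coe_mul, mul_smul]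
  rw [if_congr hiff rfl rfl] at h
  have hτ : (((τ ((w * u : σ.ker) : P.weylGroup) : ℤˣ) : ℤ) : ℝ) * (((τ w : ℤˣ) : ℤ) : ℝ) =
      (((τ u : ℤˣ) : ℤ) : ℝ) := by
    rw [Subgroup.coe_mul, map_mul, Units.val_mul, Int.cast_mul, mul_right_comm, units_sq_cast,
      one_mul]
  calc _ = ∑ x : RefinedQuotient P B M, (((τ u : ℤˣ) : ℤ) : ℝ) *
        (cas (2 * Real.pi * ⟪((w * u : σ.ker) : P.weylGroup) • b,
            (x.out : refinedLattice P B M)⟫) *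
          cas (2 * Real.pi * ⟪(w : P.weylGroup) • b', (x.out : refinedLattice P B M)⟫)) := by
        refine Finset.sum_congr rfl fun x _ => ?_
        rw [← hτ, Equiv.coe_mulLeft]
        ring
    _ = _ := by
        rw [← Finset.mul_sum, h]
        split_ifs <;> ring

variable [Finite ι] [FiniteDimensional ℝ E] [P.IsRootSystem] [P.IsCrystallographic] [P.IsReduced]
  [P.IsIrreducible]

open Classical in
/-- Discrete orthogonality of the Hartley orbit functions. -/
lemma finite_pointSet_and_scalarProduct_hartley (hP : IsEuclidean P)
    {ξ : ι} (hξ : IsHighestRoot P B ξ) {η : ι} (hη : IsHighestRoot P.flip B.flip η)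
    (τ σ : P.weylGroup →* ℤˣ) {r : Option (corootLattice P B × P.weylGroup)}
    (hr : IsChoice (generators P B ξ) σ r) {r' : Option (rootLattice P B × P.weylGroup)}
    (hr' : IsChoice (dualGenerators P B η) σ r') (hM : 0 < M) :
    (pointSet P B ξ τ σ r M).Finite ∧
    ∀ b ∈ labelSet P B η τ σ r' M, ∀ b' ∈ labelSet P B η τ σ r' M,
      scalarProduct P B σ (pointSet P B ξ τ σ r M)
          (fun a => (hartley P τ σ b a : ℂ)) (fun a => (hartley P τ σ b' a : ℂ)) =
        (connectionIndex P B : ℂ) * (Nat.card σ.ker : ℂ) * (M : ℂ) ^ finrank ℝ E *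
          (dualStabOrder P B σ M b : ℂ) * (if b = b' then 1 else 0) := by
  have := finite_refinedQuotient (B := B) hP hM
  have := Fintype.ofFinite (RefinedQuotient P B M)
  have := Fintype.ofFinite σ.ker
  have hL : ∀ (w : P.weylGroup), ∀ x ∈ corootLattice P B, w • x ∈ corootLattice P B :=
    fun w _ => smul_mem_corootLattice hP B w
  have hL' : ∀ (w : P.weylGroup), ∀ x ∈ rootLattice P B, w • x ∈ rootLattice P B :=
    fun w _ => smul_mem_rootLattice B w
  have huniq (g : corootLattice P B × P.weylGroup) (hg : σ g.2 = 1) (a : E)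
      (ha : a ∈ evenDomain P _ (alcove P B ξ) σ r)
      (hga : affAct P _ g a ∈ evenDomain P _ (alcove P B ξ) σ r) : affAct P _ g a = a :=
    affAct_eq_self_of_mem_evenDomain hL
      (fun g _ ha hga => affAct_eq_self_of_mem_alcove hP hξ g ha hga) hr hg ha hga
  have hex := exists_affAct_mem_evenDomain hL (exists_affAct_mem_alcove hP hξ) hr
  have hset : pointSet P B ξ τ σ r M =
      (refinedLattice P B M : Set E) ∩ domain P _ (alcove P B ξ) τ σ r := by
    ext x
    exact and_congr_left fun _ => mem_inv_smul_coweightLattice hM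
  have hsub : pointSet P B ξ τ σ r M ⊆
      (refinedLattice P B M : Set E) ∩ evenDomain P _ (alcove P B ξ) σ r := by
    rw [hset]
    exact Set.inter_subset_inter_right _ Set.sdiff_subset
  refine ⟨(finite_refinedLattice_inter huniq).subset hsub, fun b hb b' hb' => ?_⟩
  let F : E → ℂ := fun a => (hartley P τ σ b a : ℂ) * (hartley P τ σ b' a : ℂ)
  have hM' : (M : ℝ) ≠ 0 := by positivity
  have hb₂ := (mem_domain (P := P)).mp ((Set.mem_smul_set_iff_inv_smul_mem₀ hM' _ _).mp hb.2)
  have hb₂' := (mem_domain (P := P)).mp ((Set.mem_smul_set_iff_inv_smul_mem₀ hM' _ _).mp hb'.2)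
  have hsum : scalarProduct P B σ (pointSet P B ξ τ σ r M)
      (fun a => (hartley P τ σ b a : ℂ)) (fun a => (hartley P τ σ b' a : ℂ)) =
      ∑ x : RefinedQuotient P B M, F (x.out : refinedLattice P B M) := by
    rw [← finsum_epsilon_mul_eq hP huniq hex]
    · rw [scalarProduct, finsum_mem_def, finsum_mem_def]
      refine finsum_congr fun a => ?_
      by_cases ha : a ∈ pointSet P B ξ τ σ r M
      · rw [Set.indicator_of_mem ha, Set.indicator_of_mem (hsub ha), Complex.conj_ofReal,
          mul_assoc]
      · rw [Set.indicator_of_notMem ha]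
        by_cases ha' : a ∈ (refinedLattice P B M : Set E) ∩ evenDomain P _ (alcove P B ξ) σ r
        · rw [Set.indicator_of_mem ha']
          rw [hset] at ha
          -- A point of the even domain missing from the point set lies on the boundary, where the
          -- orbit functions vanish.
          have h₁ : ¬ ∀ g ∈ stab P _ σ a, τ g.2 = 1 :=
            fun h => ha ⟨ha'.1, mem_domain.mpr ⟨ha'.2, h⟩⟩
          push Not at h₁
          obtain ⟨g, hg, hgτ⟩ := h₁
          simp [F, hartley_eq_zero hP τ σ hb.1 hg hgτ]
        · rw [Set.indicator_of_notMem ha']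
    · intro g hg a
      have h₁ := units_sq_cast (τ g.2)
      simp only [F, ← Complex.ofReal_mul, hartley_affAct hP τ σ hb.1 g hg,
        hartley_affAct hP τ σ hb'.1 g hg]
      rw [mul_mul_mul_comm, h₁, one_mul]
  -- The congruence modulo `M Q` says that `u` carries `c/M` to `c'/M` up to a translation in `Q`.
  have hmem (u : P.weylGroup) (c c' : E) :
      (∃ q ∈ rootLattice P B, u • c - c' = (M : ℝ) • q) ↔
        (M : ℝ)⁻¹ • c' - u • ((M : ℝ)⁻¹ • c) ∈ rootLattice P B := by
    rw [smul_comm u, ← smul_sub]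
    constructor
    · rintro ⟨q, hq, h⟩
      rw [← neg_sub, h, smul_neg, inv_smul_smul₀ hM']
      exact neg_mem hq
    · intro h
      exact ⟨_, neg_mem h, by rw [smul_neg, smul_inv_smul₀ hM', neg_sub]⟩
  have hcard : (Nat.card (RefinedQuotient P B M) : ℂ) =
      connectionIndex P B * (M : ℂ) ^ finrank ℝ E := by
    exact_mod_cast congrArg (Int.cast : ℤ → ℂ) (card_refinedQuotient (B := B) hP hM)
  have hfinal : ∑ x : RefinedQuotient P B M, F (x.out : refinedLattice P B M) =
      (Nat.card (RefinedQuotient P B M) : ℂ) * ((Nat.card σ.ker : ℂ) *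
        ((dualStabOrder P B σ M b : ℂ) * if b = b' then 1 else 0)) := by
    simp only [F, ← Complex.ofReal_mul, ← Complex.ofReal_sum]
    rw [sum_hartley_mul_hartley hP τ σ hM hb.1 hb'.1, Finset.sum_const, Finset.card_univ,
      nsmul_eq_mul, Nat.card_eq_fintype_card (α := σ.ker)]
    have h₁ : (∑ u : σ.ker, if ∃ q ∈ rootLattice P B, (u : P.weylGroup) • b - b' = (M : ℝ) • q then
        (((τ u : ℤˣ) : ℤ) : ℝ) else 0) =
          (dualStabOrder P B σ M b : ℝ) * if b = b' then 1 else 0 := by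
      split_ifs with hbb
      · subst hbb
        rw [mul_one, dualStabOrder, stab_ncard, Nat.card_eq_fintype_card, Fintype.card_subtype,
          Finset.card_filter, Nat.cast_sum]
        refine Finset.sum_congr rfl fun u _ => ?_
        rw [if_congr (hmem u b b) rfl rfl]
        split_ifs with h
        · have h₂ := hb₂.2 (⟨_, h⟩, u) ⟨u.2, by simp [affAct]⟩
          simp only at h₂
          simp [h₂]
        · simp
      · rw [mul_zero]
        refine Finset.sum_eq_zero fun u _ => if_neg fun h => hbb ?_
        rw [hmem] at h
        have h₂ : affAct P _ ((⟨_, h⟩, u) : rootLattice P B × P.weylGroup) ((M : ℝ)⁻¹ • b) =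
            (M : ℝ)⁻¹ • b' := by simp [affAct]
        have h₃ := affAct_eq_self_of_mem_evenDomain hL'
          (fun g _ ha hga => affAct_eq_self_of_mem_dualAlcove hP hη g ha hga) hr'
          (h := (⟨_, h⟩, u)) u.2 hb₂.1 (by rw [h₂]; exact hb₂'.1)
        rw [h₂] at h₃
        exact (smul_right_injective E (inv_ne_zero hM') h₃).symm
    rw [h₁]
    split_ifs <;> simp
  rw [hsum, hfinal, hcard]
  ring

end Main

end WeylOrbit

open Classical in
theorem mainTheorem2 {ι : Type*} [Finite ι] {n : ℕ}
    (P : RootPairing ι ℝ (EuclideanSpace ℝ (Fin n)) (EuclideanSpace ℝ (Fin n)))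
    [P.IsRootSystem] [P.IsCrystallographic] [P.IsReduced] [P.IsIrreducible]
    (hP : WeylOrbit.IsEuclidean P) (B : P.Base)
    (ξ : ι) (hξ : WeylOrbit.IsHighestRoot P B ξ)
    (η : ι) (hη : WeylOrbit.IsHighestRoot P.flip B.flip η)
    (τ σ : P.weylGroup →* ℤˣ)
    (r : Option (WeylOrbit.corootLattice P B × P.weylGroup))
    (hr : WeylOrbit.IsChoice (WeylOrbit.generators P B ξ) σ r)
    (r' : Option (WeylOrbit.rootLattice P B × P.weylGroup))
    (hr' : WeylOrbit.IsChoice (WeylOrbit.dualGenerators P B η) σ r')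
    (M : ℕ) (hM : 0 < M) :
    (WeylOrbit.pointSet P B ξ τ σ r M).Finite ∧
    ∀ b ∈ WeylOrbit.labelSet P B η τ σ r' M, ∀ b' ∈ WeylOrbit.labelSet P B η τ σ r' M,
      WeylOrbit.scalarProduct P B σ (WeylOrbit.pointSet P B ξ τ σ r M)
          (fun a => (WeylOrbit.hartley P τ σ b a : ℂ))
          (fun a => (WeylOrbit.hartley P τ σ b' a : ℂ)) =
        (WeylOrbit.connectionIndex P B : ℂ) * (Nat.card σ.ker : ℂ) * (M : ℂ) ^ n *
          (WeylOrbit.dualStabOrder P B σ M b : ℂ) * (if b = b' then 1 else 0) := by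
  have h := WeylOrbit.finite_pointSet_and_scalarProduct_hartley hP hξ hη τ σ hr hr' hM
  rw [finrank_euclideanSpace_fin] at h
  convert h
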